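/- **Setting.** An arena is a finite directed graph without terminal vertices on a vertex set $V$ partitioned into the vertices $V_0$ of Player 0 and $V_1$ of Player 1, with an initial vertex $v_I$; a play is an infinite path from $v_I$. A *Streett game with costs* $\mathcal G$ with $d \ge 1$ pairs consists of an arena, pairs $(Q_c,P_c)_{c<d}$ of subsets of $V$, and cost functions $\mathrm{Cst}_c\colon E\to\mathbb N$ for $c<d$, extended to finite paths by summation; it is *finitary* if every $\mathrm{Cst}_c$ assigns $1$ to every edge. For a play $\rho=v_0v_1v_2\cdots$ and a position $j$ let $\mathrm{StCor}_c(\rho,j)=\min\{\mathrm{Cst}_c(v_j\cdots v_{k})\mid k\ge j,\ v_{k}\in P_c\}$ if $v_j\in Q_c$ (with $\min\emptyset=\infty$), and $\mathrm{StCor}_c(\rho,j)=0$ otherwise; let $\mathrm{StCor}(\rho,j)=\max_{c}\mathrm{StCor}_c(\rho,j)$ and $\mathrm{Cst}(\rho)=\limsup_{j\to\infty}\mathrm{StCor}(\rho,j)\in\mathbb N\cup\{\infty\}$. A strategy for Player $i$ maps every word in $V^*V_i$ to a successor of its last vertex. For a strategy $\sigma$ of Player 0, $\mathrm{Cst}(\sigma)$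 is the supremum of $\mathrm{Cst}(\rho)$ over all plays $\rho$ consistent with $\sigma$; for a strategy $\tau$ of Player 1, $\mathrm{Cst}(\tau)$ is the infimum of $\mathrm{Cst}(\rho)$ over all plays $\rho$ consistent with $\tau$. The size $|\sigma|$ of a strategy is the least number of states of a memory structure (initial state, update function on memory states and edges, and next-move function depending on the current vertex and memory state) that implements it, and $\infty$ if there is none. **Theorem.** Let $\mathcal G$ be a Streett game with costs with $n$ vertices and $d\ge 1$ Streett pairs, and let $b\in\mathbb N$. 1. If Player 0 has a strategy $\sigma$ in $\mathcal G$ with $\mathrm{Cst}(\sigma)\le b$, then she also has a strategy $\sigma'$ with $\mathrm{Cst}(\sigma')\le b$ and $|\sigma'|\le (d+1)!\cdot(b+2)^d$. 2. If Player 1 has a strategy $\tau$ in $\mathcal G$ with $\mathrm{Cst}(\tau)\ge b$, then he also has a strategy $\tau'$ with $\mathrm{Cst}(\tau')\ge b$ and $|\tau'|\le n(b+2)^d$. These exponential bounds are matched by exponential lower bounds already for finitary Streett games with $n$ and $b$ polynomial in $d$, in the following sense. 3. For every $d\ge1$ there is a finitary Streett game $\mathcal G_d$ with $d$ Streett pairs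 and $O(d^2)$ vertices in which Player 0 has a strategy of cost $d^2+2d$, but every strategy $\sigma$ of Player 0 with $\mathrm{Cst}(\sigma)\le d^2+2d$ has $|\sigma|\ge 2^{d-1}$. 4. For every $d\ge1$ there is a finitary Streett game $\mathcal G'_d$ with $2d$ Streett pairs and $O(d)$ vertices in which Player 1 has a strategy of cost $5(d-1)+7$, but every strategy $\tau$ of Player 1 with $\mathrm{Cst}(\tau)\ge 5(d-1)+7$ has $|\tau|\ge 2^{d}$. -/

import Mathlib

/-- An arena: a directed graph without terminal vertices, whose vertices are partitioned between
Player `0` and Player `1` (given by `owner`), and an initial vertex.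
Finiteness of the vertex set `V` is assumed where arenas are used. -/
structure Arena (V : Type*) where
  owner : V → Fin 2
  Adj : V → V → Prop
  init : V
  exists_succ : ∀ v, ∃ w, Adj v w

namespace Arena

variable {V : Type*} (A : Arena V)

/-- A play is an infinite path starting in the initial vertex. -/
def IsPlay (ρ : ℕ → V) : Prop :=
  ρ 0 = A.init ∧ ∀ j, A.Adj (ρ j) (ρ (j + 1))

/-- A strategy `σ : V* V_i → V` for Player `i`: the value at the word `w v` is `move w v`.
(Values at words that do not end in a vertex of Player `i` are irrelevant.) -/
structure Strategy (i : Fin 2) where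
  move : List V → V → V
  adj_move : ∀ w v, A.owner v = i → A.Adj v (move w v)

/-- A memory structure with `k` memory states. The update function is only ever relevant at
triples `m v v'` such that `(v, v')` is an edge. -/
structure Memory (V : Type*) (k : ℕ) where
  init : Fin k
  upd : Fin k → V → V → Fin k

/-- The extension of the update function to finite words: `Upd⁺(m, v) = m` and
`Upd⁺(m, w v v') = Upd(Upd⁺(m, w v), (v, v'))`; see `Memory.updPlus_append`. -/
def Memory.updPlus {V : Type*} {k : ℕ} (M : Memory V k) : Fin k → List V → Fin k
  | m, [] => m
  | m, [_] => m
  | m, u :: v :: w => M.updPlus (M.upd m u v) (v :: w)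

theorem Memory.updPlus_append {V : Type*} {k : ℕ} (M : Memory V k) (m : Fin k) (w : List V)
    (v v' : V) :
    M.updPlus m (w ++ [v, v']) = M.upd (M.updPlus m (w ++ [v])) v v' := by
  induction w generalizing m with
  | nil => simp [Memory.updPlus]
  | cons a w ih =>
    cases w with
    | nil => simp [Memory.updPlus]
    | cons a' w =>
      have h := ih (M.upd m a a')
      simpa [Memory.updPlus] using h

variable {A}

/-- The play `ρ` is consistent with the strategy `σ` for Player `i`. -/
def Strategy.Consistent {i : Fin 2} (σ : A.Strategy i) (ρ : ℕ → V) : Prop :=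
  ∀ j, A.owner (ρ j) = i → ρ (j + 1) = σ.move ((List.range j).map ρ) (ρ j)

/-- The strategy `σ` is implemented by a memory structure with `k` states together with a
next-move function `nxt : V_i × M → V`, i.e. `σ(v₀ ⋯ vⱼ) = nxt(vⱼ, Upd⁺(m_I, v₀ ⋯ vⱼ))` for all
finite paths `v₀ ⋯ vⱼ` of the arena that end in a vertex of Player `i`. -/
def Strategy.ImplementableWith {i : Fin 2} (σ : A.Strategy i) (k : ℕ) : Prop :=
  ∃ (M : Memory V k) (nxt : V → Fin k → V),
    (∀ v m, A.owner v = i → A.Adj v (nxt v m)) ∧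
    ∀ w v, (w ++ [v]).IsChain A.Adj → A.owner v = i →
      σ.move w v = nxt v (M.updPlus M.init (w ++ [v]))

/-- The size of a strategy: the least number of states of a memory structure implementing it
(`⊤` if it is not finite-state). -/
noncomputable def Strategy.size {i : Fin 2} (σ : A.Strategy i) : ℕ∞ :=
  ⨅ (k : ℕ) (_ : σ.ImplementableWith k), (k : ℕ∞)

end Arena

/-- A Streett game with costs with `d` Streett pairs `(Q c, P c)`, each with its own cost function
`cost c` on edges (values of `cost c` at non-edges are irrelevant). -/
structure StreettGame (V : Type*) (d : ℕ) extends Arena V where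
  Q : Fin d → Set V
  P : Fin d → Set V
  cost : Fin d → V → V → ℕ

namespace StreettGame

variable {V : Type*} {d : ℕ} (G : StreettGame V d)

/-- A finitary Streett game: all edges have cost `1` with respect to every Streett pair. -/
def IsFinitary : Prop :=
  ∀ c v w, G.Adj v w → G.cost c v w = 1

/-- The cost of the infix `ρ j ⋯ ρ k` with respect to the `c`-th cost function. -/
def infixCost (c : Fin d) (ρ : ℕ → V) (j k : ℕ) : ℕ :=
  ∑ l ∈ Finset.Ico j k, G.cost c (ρ l) (ρ (l + 1))

open Classical in
/-- The cost-of-response at position `j` for the `c`-th Streett pair: if `ρ j ∈ Q c`, the least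
cost of an infix `ρ j ⋯ ρ k` with `j ≤ k` and `ρ k ∈ P c` (and `∞` if there is none), else `0`. -/
noncomputable def stCorPair (c : Fin d) (ρ : ℕ → V) (j : ℕ) : ℕ∞ :=
  if ρ j ∈ G.Q c then ⨅ (k : ℕ) (_ : j ≤ k ∧ ρ k ∈ G.P c), (G.infixCost c ρ j k : ℕ∞) else 0

/-- The (total) cost-of-response at position `j`: the maximum over all Streett pairs. -/
noncomputable def stCor (ρ : ℕ → V) (j : ℕ) : ℕ∞ :=
  ⨆ c : Fin d, G.stCorPair c ρ j

/-- The cost of a play: the limit superior of its costs-of-response. -/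
noncomputable def playCost (ρ : ℕ → V) : ℕ∞ :=
  Filter.limsup (fun j => G.stCor ρ j) Filter.atTop

/-- The cost of a strategy for Player `0`: the supremum of the costs of its consistent plays. -/
noncomputable def cost₀ (σ : G.toArena.Strategy 0) : ℕ∞ :=
  ⨆ (ρ : ℕ → V) (_ : G.toArena.IsPlay ρ ∧ σ.Consistent ρ), G.playCost ρ

/-- The cost of a strategy for Player `1`: the infimum of the costs of its consistent plays. -/
noncomputable def cost₁ (τ : G.toArena.Strategy 1) : ℕ∞ :=
  ⨅ (ρ : ℕ → V) (_ : G.toArena.IsPlay ρ ∧ τ.Consistent ρ), G.playCost ρ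

end StreettGame

/-! Upper bounds. Whether a play costs at most `b` can be observed by a finite tracker. For each
pair it stores, in `Option (Fin (b + 1))`, the cost accumulated since an open request; when this
exceeds `b` it forgets the request and raises a flag. The cost is at most `b` iff the flag is raised
only finitely often and the classical Streett condition holds (`playCost_le_iff_track`); the latter
is needed because edges may cost 0, so an unanswered request need not overflow. The product with the
`(b + 2) ^ d * 2` tracker states is therefore a Streett game with an extra co-Büchi condition.

Such games are determined, with `d!` memory states for Player 0 and none for Player 1
(`determined_streett`, `determined_coBuchi`). Outside Player 0's attractor of `P c`, the pair `c`
degenerates to a co-Büchi condition on `Q c`, leaving one pair fewer. If Player 0 wins all these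
subgames, she visits the `P c` in turn (`exists_roundRobin`), which multiplies the memory by the
number of pairs; otherwise part of Player 1's winning region is removed. Multiplying by the tracker
gives the bounds: the factor 2 of the flag is absorbed by `d + 1` or by the number of vertices, and
cost at least `b` for Player 1 is failure of the threshold `b - 1`.

Lower bounds. Both games are played in rounds; all pairs are requested at the start of a round, and
one player must remember bits chosen by the other. In `detourGame` Player 0 has to take exactly
those detours that Player 1 did not take. In `recallGame` Player 1 has to repeat one queried bit.
With fewer memory states than bit strings, the pigeonhole principle yields, for each memory state at
the start of a round, bits on which the automaton errs. An opponent simulating the automaton plays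
them in every round, so the limit superior registers the errors. -/

namespace GraphGame

/-! ### Attractors and the composition of winning strategies on finite graphs -/

open Filter

variable {X : Type*} (own : X → Fin 2) (E : X → X → Prop)

/-- A set of vertices inducing a subgame without terminal vertices. -/
def IsSubarena (S : Set X) : Prop := ∀ v ∈ S, ∃ w ∈ S, E v w

/-- `A` is an attractor of `N` for Player `i` in `S`, as witnessed by the rank function `rk` and the
positional strategy `f`. -/
structure IsAttractor (i : Fin 2) (S N A : Set X) (rk : X → ℕ) (f : X → X) : Prop where
  base : N ⊆ A
  subset : A ⊆ S
  move : ∀ v ∈ A, v ∉ N → own v = i → E v (f v) ∧ f v ∈ A ∧ rk (f v) < rk v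
  opp : ∀ v ∈ A, v ∉ N → own v ≠ i → ∀ w ∈ S, E v w → w ∈ A ∧ rk w < rk v
  compl_own : ∀ v ∈ S, v ∉ A → own v = i → ∀ w ∈ S, E v w → w ∉ A
  compl_opp : ∀ v ∈ S, v ∉ A → own v ≠ i → ∃ w ∈ S, E v w ∧ w ∉ A

/-- The attractor of `N` for Player `i` in `S`, together with a rank function and a positional
attractor strategy. -/
theorem exists_attractor [Finite X] (i : Fin 2) {S N : Set X} (hN : N ⊆ S) :
    ∃ (A : Set X) (rk : X → ℕ) (f : X → X), IsAttractor own E i S N A rk f := by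
  classical
  let L : ℕ → Set X := fun n => Nat.rec N (fun _ T => T ∪ {v | v ∈ S ∧
    ((own v = i ∧ ∃ w ∈ T, E v w) ∨ (own v ≠ i ∧ ∀ w ∈ S, E v w → w ∈ T))}) n
  have hLs : ∀ n v, v ∈ L (n + 1) ↔ v ∈ L n ∨ (v ∈ S ∧
    ((own v = i ∧ ∃ w ∈ L n, E v w) ∨ (own v ≠ i ∧ ∀ w ∈ S, E v w → w ∈ L n))) :=
    fun n v => Iff.rfl
  have hmono : Monotone L := monotone_nat_of_le_succ fun n v hv => (hLs n v).2 (Or.inl hv)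
  have hLS : ∀ n, L n ⊆ S := by
    intro n
    induction n with
    | zero => exact hN
    | succ n ih =>
      intro v hv
      rcases (hLs n v).1 hv with h | h
      · exact ih h
      · exact h.1
  let rk : X → ℕ := fun v => sInf {n | v ∈ L n}
  have hrk : ∀ v n, v ∈ L n → rk v ≤ n := fun v n h => Nat.sInf_le h
  have hpred : ∀ v ∈ ⋃ n, L n, v ∉ N → ∃ n, rk v = n + 1 ∧
      ((own v = i ∧ ∃ w ∈ L n, E v w) ∨ (own v ≠ i ∧ ∀ w ∈ S, E v w → w ∈ L n)) := by
    intro v hv hvN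
    obtain ⟨n, hn⟩ := Set.mem_iUnion.1 hv
    have hmem : v ∈ L (rk v) := Nat.sInf_mem (s := {n | v ∈ L n}) ⟨n, hn⟩
    cases hr : rk v with
    | zero => rw [hr] at hmem; exact absurd hmem hvN
    | succ k =>
      rw [hr] at hmem
      refine ⟨k, rfl, ?_⟩
      rcases (hLs k v).1 hmem with h | h
      · have := hrk v k h
        omega
      · exact h.2
  have hf : ∀ v, ∃ w, v ∈ ⋃ n, L n → v ∉ N → own v = i →
      E v w ∧ w ∈ (⋃ n, L n) ∧ rk w < rk v := by
    intro v
    by_cases h : v ∈ (⋃ n, L n) ∧ v ∉ N ∧ own v = i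
    · obtain ⟨n, hn, ⟨-, w, hw, hE⟩ | ⟨h', -⟩⟩ := hpred v h.1 h.2.1
      · refine ⟨w, fun _ _ _ => ⟨hE, Set.mem_iUnion.2 ⟨n, hw⟩, ?_⟩⟩
        have := hrk w n hw
        omega
      · exact absurd h.2.2 h'
    · exact ⟨v, fun h1 h2 h3 => absurd ⟨h1, h2, h3⟩ h⟩
  choose f hf using hf
  refine ⟨⋃ n, L n, rk, f, fun v hv => Set.mem_iUnion.2 ⟨0, hv⟩, Set.iUnion_subset hLS,
    hf, ?_, ?_, ?_⟩
  · intro v hv hvN ho w hw hE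
    obtain ⟨n, hn, ⟨h', -⟩ | ⟨-, h'⟩⟩ := hpred v hv hvN
    · exact absurd h' ho
    · have h1 := h' w hw hE
      have := hrk w n h1
      exact ⟨Set.mem_iUnion.2 ⟨n, h1⟩, by omega⟩
  · intro v hv hvA ho w hw hE hwA
    obtain ⟨n, hn⟩ := Set.mem_iUnion.1 hwA
    exact hvA (Set.mem_iUnion.2 ⟨n + 1, (hLs n v).2 (Or.inr ⟨hv, Or.inl ⟨ho, w, hn, hE⟩⟩)⟩)
  · intro v hv hvA ho
    by_contra hcon
    push Not at hcon
    have hex : ∀ w, ∃ n, w ∈ S → E v w → w ∈ L n := by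
      intro w
      by_cases h : w ∈ S ∧ E v w
      · obtain ⟨n, hn⟩ := Set.mem_iUnion.1 (hcon w h.1 h.2)
        exact ⟨n, fun _ _ => hn⟩
      · exact ⟨0, fun h1 h2 => absurd ⟨h1, h2⟩ h⟩
    choose g hg using hex
    -- Finiteness of `X` puts all successors into one common layer, so the vertex itself would enter
    -- the next layer.
    obtain ⟨n, hn⟩ := (Set.finite_range g).bddAbove
    exact hvA (Set.mem_iUnion.2 ⟨n + 1, (hLs n v).2 (Or.inr ⟨hv, Or.inr ⟨ho, fun w hw hE =>
      hmono (hn ⟨w, rfl⟩) (hg w hw hE)⟩⟩)⟩)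

theorem IsSubarena.diff {i : Fin 2} {S N A : Set X} {rk : X → ℕ} {f : X → X}
    (hS : IsSubarena E S) (hA : IsAttractor own E i S N A rk f) : IsSubarena E (S \ A) := by
  rintro v ⟨hv, hvA⟩
  by_cases ho : own v = i
  · obtain ⟨w, hw, hE⟩ := hS v hv
    exact ⟨w, ⟨hw, hA.compl_own v hv hvA ho w hw hE⟩, hE⟩
  · obtain ⟨w, hw, hE, hwA⟩ := hA.compl_opp v hv hvA ho
    exact ⟨w, ⟨hw, hwA⟩, hE⟩

/-- A strategy with memory `M`, which can be started in every vertex. -/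
structure MemStrategy (X M : Type*) where
  nxt : X → M → X
  upd : M → X → X → M
  ini : X → M

/-- The sequences of vertices in `S` and memory states that are consistent with `s`. -/
def IsRun {M : Type*} (i : Fin 2) (s : MemStrategy X M) (S : Set X) (x : ℕ → X) (m : ℕ → M) :
    Prop :=
  ∀ j, x j ∈ S ∧ E (x j) (x (j + 1)) ∧ m (j + 1) = s.upd (m j) (x j) (x (j + 1)) ∧
    (own (x j) = i → x (j + 1) = s.nxt (x j) (m j))

/-- In the subgame `S`, the strategy `s` for Player `i` keeps the play in `W` and enforces `Φ`
from every vertex of `W`. -/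
structure Wins {M : Type*} (i : Fin 2) (s : MemStrategy X M) (S W : Set X)
    (Φ : (ℕ → X) → Prop) : Prop where
  subset : W ⊆ S
  move : ∀ v ∈ W, own v = i → ∀ m, E v (s.nxt v m) ∧ s.nxt v m ∈ W
  closed : ∀ v ∈ W, own v ≠ i → ∀ w ∈ S, E v w → w ∈ W
  wins : ∀ x m, IsRun own E i s S x m → x 0 ∈ W → m 0 = s.ini (x 0) → Φ x

variable {own E}

/-- `Wins.move` is required for every memory state, not only the reachable ones, so staying in `W`
does not depend on how the memory was initialised. -/
theorem Wins.mem_of_isRun {M : Type*} {i : Fin 2} {s : MemStrategy X M} {S W : Set X}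
    {Φ : (ℕ → X) → Prop} (h : Wins own E i s S W Φ) {x : ℕ → X} {m : ℕ → M}
    (hr : IsRun own E i s S x m) (h0 : x 0 ∈ W) (j : ℕ) : x j ∈ W := by
  induction j with
  | zero => exact h0
  | succ j ih =>
    obtain ⟨-, hE, -, hn⟩ := hr j
    by_cases ho : own (x j) = i
    · rw [hn ho]
      exact (h.move _ ih ho _).2
    · exact h.closed _ ih ho _ (hr (j + 1)).1 hE

theorem Wins.mono {M : Type*} {i : Fin 2} {s : MemStrategy X M} {S W : Set X}
    {Φ Ψ : (ℕ → X) → Prop} (h : Wins own E i s S W Φ)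
    (hΦ : ∀ x, (∀ j, x j ∈ W) → Φ x → Ψ x) : Wins own E i s S W Ψ :=
  ⟨h.subset, h.move, h.closed, fun x m hr h0 hm =>
    hΦ x (h.mem_of_isRun hr h0) (h.wins x m hr h0 hm)⟩

/-- Winning in a subgame which the opponent cannot leave. -/
theorem Wins.lift {M : Type*} {i : Fin 2} {s : MemStrategy X M} {S A W : Set X}
    {Φ : (ℕ → X) → Prop} (h : Wins own E i s (S \ A) W Φ)
    (hA : ∀ v ∈ S, v ∉ A → own v ≠ i → ∀ w ∈ S, E v w → w ∉ A) : Wins own E i s S W Φ := by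
  have hcl : ∀ v ∈ W, own v ≠ i → ∀ w ∈ S, E v w → w ∈ W := fun v hv ho w hw hE =>
    h.closed v hv ho w ⟨hw, hA v (h.subset hv).1 (h.subset hv).2 ho w hw hE⟩ hE
  refine ⟨fun v hv => (h.subset hv).1, h.move, hcl, fun x m hr h0 hm => ?_⟩
  have hW : ∀ j, x j ∈ W := by
    intro j
    induction j with
    | zero => exact h0
    | succ j ih =>
      obtain ⟨-, hE, -, hn⟩ := hr j
      by_cases ho : own (x j) = i
      · rw [hn ho]
        exact (h.move _ ih ho _).2
      · exact hcl _ ih ho _ (hr (j + 1)).1 hE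
  exact h.wins x m (fun j => ⟨h.subset (hW j), (hr j).2⟩) h0 hm

theorem Wins.transport {M M' : Type*} {i : Fin 2} {s : MemStrategy X M} {S W : Set X}
    {Φ : (ℕ → X) → Prop} (h : Wins own E i s S W Φ) (e : M ≃ M') :
    ∃ s' : MemStrategy X M', Wins own E i s' S W Φ := by
  refine ⟨⟨fun v m => s.nxt v (e.symm m), fun m v w => e (s.upd (e.symm m) v w),
    fun v => e (s.ini v)⟩, h.subset, fun v hv ho m => h.move v hv ho _, h.closed,
    fun x m hr h0 hm => h.wins x (fun j => e.symm (m j)) (fun j => ?_) h0 (by simp [hm])⟩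
  obtain ⟨h1, h2, h3, h4⟩ := hr j
  exact ⟨h1, h2, by simp [h3], h4⟩

/-- A winning region `Y` can be enlarged by a set `Z` of vertices in which a strategy either
reaches `Y` or stays in `Z` and wins. -/
theorem Wins.union {M : Type*} {i : Fin 2} {s t : MemStrategy X M} {S Y Z : Set X}
    {Φ : (ℕ → X) → Prop} (hY : Wins own E i s S Y Φ) (hΦ : ∀ x n, Φ (fun j => x (n + j)) → Φ x)
    (hZ : Z ⊆ S)
    (hmove : ∀ v ∈ Z, own v = i → ∀ m, E v (t.nxt v m) ∧ t.nxt v m ∈ Y ∪ Z)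
    (hclosed : ∀ v ∈ Z, own v ≠ i → ∀ w ∈ S, E v w → w ∈ Y ∪ Z)
    (hwins : ∀ x m, IsRun own E i t S x m → (∀ j, x j ∈ Z) → m 0 = t.ini (x 0) → Φ x) :
    ∃ r : MemStrategy X M, Wins own E i r S (Y ∪ Z) Φ := by
  classical
  -- The current vertex tells which strategy is active and `Y` is never left, so both share the
  -- memory `M`, which is reinitialised on entering `Y`.
  let r : MemStrategy X M :=
    ⟨fun v m => if v ∈ Y then s.nxt v m else t.nxt v m,
     fun m v w => if v ∈ Y then s.upd m v w else if w ∈ Y then s.ini w else t.upd m v w,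
     fun v => if v ∈ Y then s.ini v else t.ini v⟩
  have hm : ∀ v ∈ Y ∪ Z, own v = i → ∀ m, E v (r.nxt v m) ∧ r.nxt v m ∈ Y ∪ Z := by
    intro v hv ho m
    by_cases hvY : v ∈ Y
    · simp only [r, if_pos hvY]
      exact ⟨(hY.move v hvY ho m).1, Or.inl (hY.move v hvY ho m).2⟩
    · simp only [r, if_neg hvY]
      exact hmove v (hv.resolve_left hvY) ho m
  have hc : ∀ v ∈ Y ∪ Z, own v ≠ i → ∀ w ∈ S, E v w → w ∈ Y ∪ Z := by
    intro v hv ho w hw hE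
    by_cases hvY : v ∈ Y
    · exact Or.inl (hY.closed v hvY ho w hw hE)
    · exact hclosed v (hv.resolve_left hvY) ho w hw hE
  refine ⟨r, Set.union_subset hY.subset hZ, hm, hc, fun x m hr h0 hm0 => ?_⟩
  by_cases hex : ∃ j, x j ∈ Y
  -- From the first visit to `Y` on, the run is a run of `s` with correctly initialised memory; `hΦ`
  -- discards the prefix.
  · have hJ := Nat.find_spec hex
    set J := Nat.find hex with hJdef
    have hmJ : m J = s.ini (x J) := by
      rcases Nat.eq_zero_or_pos J with h | h
      · rw [h] at hJ ⊢
        rw [hm0]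
        simp only [r, if_pos hJ]
      · obtain ⟨k, hk⟩ : ∃ k, J = k + 1 := ⟨J - 1, by omega⟩
        have hkY : x k ∉ Y := Nat.find_min hex (by omega)
        rw [hk] at hJ ⊢
        rw [(hr k).2.2.1]
        simp only [r, if_neg hkY, if_pos hJ]
    have hYall : ∀ n, x (J + n) ∈ Y := by
      intro n
      induction n with
      | zero => exact hJ
      | succ n ih =>
        obtain ⟨-, hE, -, hn⟩ := hr (J + n)
        by_cases ho : own (x (J + n)) = i
        · rw [← add_assoc, hn ho]
          simp only [r, if_pos ih]
          exact (hY.move _ ih ho _).2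
        · exact hY.closed _ ih ho _ (hr (J + n + 1)).1 hE
    refine hΦ x J (hY.wins _ (fun j => m (J + j)) (fun j => ?_) hJ hmJ)
    obtain ⟨h1, h2, h3, h4⟩ := hr (J + j)
    refine ⟨h1, h2, ?_, fun ho => ?_⟩
    · change m (J + j + 1) = s.upd (m (J + j)) (x (J + j)) (x (J + j + 1))
      rw [h3]
      simp only [r, if_pos (hYall j)]
    · rw [← add_assoc, h4 ho]
      simp only [r, if_pos (hYall j)]
  · push Not at hex
    have hZall : ∀ j, x j ∈ Z := by
      intro j
      induction j with
      | zero => exact h0.resolve_left (hex 0)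
      | succ j ih =>
        obtain ⟨-, hE, -, hn⟩ := hr j
        by_cases ho : own (x j) = i
        · have := (hm _ (Or.inr ih) ho (m j)).2
          rw [← hn ho] at this
          exact this.resolve_left (hex _)
        · exact (hclosed _ ih ho _ (hr (j + 1)).1 hE).resolve_left (hex _)
    refine hwins x m (fun j => ?_) hZall (by rw [hm0]; simp only [r, if_neg (hex 0)])
    obtain ⟨h1, h2, h3, h4⟩ := hr j
    refine ⟨h1, h2, ?_, fun ho => ?_⟩
    · rw [h3]
      simp only [r, if_neg (hex _)]
    · rw [h4 ho]
      simp only [r, if_neg (hex _)]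

/-- There is no infinite descent in `ℕ`; applied to attractor ranks along a run, it shows that the
target is reached. -/
theorem exists_le_succ (u : ℕ → ℕ) : ∃ j, u j ≤ u (j + 1) := by
  by_contra! h
  have h1 : ∀ j, u j + j ≤ u 0 := by
    intro j
    induction j with
    | zero => simp
    | succ j ih => have := h j; omega
  have := h1 (u 0 + 1)
  omega

/-- A winning region can be enlarged to its attractor. -/
theorem Wins.attractor {M : Type*} [Nonempty M] {i : Fin 2} {s : MemStrategy X M} {S Y A : Set X}
    {rk : X → ℕ} {f : X → X}
    {Φ : (ℕ → X) → Prop} (hY : Wins own E i s S Y Φ) (hΦ : ∀ x n, Φ (fun j => x (n + j)) → Φ x)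
    (hA : IsAttractor own E i S Y A rk f) :
    ∃ r : MemStrategy X M, Wins own E i r S A Φ := by
  have hYA : Y ∪ A \ Y = A := by
    rw [Set.union_sdiff_self, Set.union_eq_right.2 hA.base]
  have m₀ : M := Classical.arbitrary M
  have := hY.union (t := ⟨fun v _ => f v, fun _ _ _ => m₀, fun _ => m₀⟩) (Z := A \ Y) hΦ
    (fun v hv => hA.subset hv.1) ?_ ?_ ?_
  · rwa [hYA] at this
  · intro v hv ho _
    rw [hYA]
    exact ⟨(hA.move v hv.1 hv.2 ho).1, (hA.move v hv.1 hv.2 ho).2.1⟩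
  · intro v hv ho w hw hE
    rw [hYA]
    exact (hA.opp v hv.1 hv.2 ho w hw hE).1
  · intro x m hr hZ _
    exfalso
    obtain ⟨j, hj⟩ := exists_le_succ (fun j => rk (x j))
    by_cases ho : own (x j) = i
    · have := (hA.move _ (hZ j).1 (hZ j).2 ho).2.2
      rw [(hr j).2.2.2 ho] at hj
      exact absurd this (not_lt.2 hj)
    · have := (hA.opp _ (hZ j).1 (hZ j).2 ho _ (hr (j + 1)).1 (hr j).2.1).2
      exact absurd this (not_lt.2 hj)

/-- Visiting targets in a round-robin fashion: for each `c`, Player `i` can win `Φ c` outside of the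
attractor of `N c`. -/
theorem exists_roundRobin {k K : ℕ} [NeZero k] {i : Fin 2} {S : Set X} (hS : IsSubarena E S)
    {N A : Fin k → Set X} {rk : Fin k → X → ℕ} {f : Fin k → X → X}
    (hA : ∀ c, IsAttractor own E i S (N c) (A c) (rk c) (f c))
    {s : Fin k → MemStrategy X (Fin K)} {Φ : Fin k → (ℕ → X) → Prop}
    (hs : ∀ c, Wins own E i (s c) (S \ A c) (S \ A c) (Φ c))
    (hΦ : ∀ c x n, Φ c (fun j => x (n + j)) → Φ c x) :
    ∃ r : MemStrategy X (Fin (k * K)),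
      Wins own E i r S S (fun x => (∀ c, ∃ᶠ j in atTop, x j ∈ N c) ∨ ∃ c, Φ c x) := by
  classical
  have hg : ∀ v, ∃ w, v ∈ S → w ∈ S ∧ E v w := by
    intro v
    by_cases hv : v ∈ S
    · obtain ⟨w, hw⟩ := hS v hv
      exact ⟨w, fun _ => hw⟩
    · exact ⟨v, fun h => absurd h hv⟩
  choose g hg using hg
  -- The first component is the current target `c`. On `N c` the target advances; on the rest of `A
  -- c` the attractor strategy is followed while the memory of `s c` is kept freshly initialised;
  -- outside `A c` the strategy `s c` is played.
  let r : MemStrategy X (Fin k × Fin K) :=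
    ⟨fun v m => if v ∈ N m.1 then g v else if v ∈ A m.1 then f m.1 v else (s m.1).nxt v m.2,
     fun m v w => if v ∈ N m.1 then (m.1 + 1, (s (m.1 + 1)).ini w)
       else if v ∈ A m.1 then (m.1, (s m.1).ini w) else (m.1, (s m.1).upd m.2 v w),
     fun v => (0, (s 0).ini v)⟩
  suffices h : Wins own E i r S S (fun x => (∀ c, ∃ᶠ j in atTop, x j ∈ N c) ∨ ∃ c, Φ c x) from
    h.transport finProdFinEquiv
  refine ⟨subset_rfl, ?_, fun _ _ _ w hw _ => hw, ?_⟩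
  · intro v hv ho m
    by_cases h1 : v ∈ N m.1
    · simp only [r, if_pos h1]
      exact ⟨(hg v hv).2, (hg v hv).1⟩
    · by_cases h2 : v ∈ A m.1
      · simp only [r, if_neg h1, if_pos h2]
        have := (hA m.1).move v h2 h1 ho
        exact ⟨this.1, (hA m.1).subset this.2.1⟩
      · simp only [r, if_neg h1, if_neg h2]
        have := (hs m.1).move v ⟨hv, h2⟩ ho m.2
        exact ⟨this.1, this.2.1⟩
  · intro x m hr _ hm0
    -- Either the current target is hit infinitely often, and then the mode cycles through all
    -- targets; or the mode is eventually a constant `c`, and `A c` is eventually avoided because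
    -- its ranks would descend to `N c`.
    by_cases hfr : ∃ᶠ j in atTop, x j ∈ N (m j).1
    · left
      have hstep : ∀ j, x j ∈ N (m j).1 → (m (j + 1)).1 = (m j).1 + 1 := by
        intro j hj
        rw [(hr j).2.2.1]
        simp only [r, if_pos hj]
      have hstay : ∀ j, x j ∉ N (m j).1 → (m (j + 1)).1 = (m j).1 := by
        intro j hj
        rw [(hr j).2.2.1]
        by_cases h2 : x j ∈ A (m j).1
        · simp only [r, if_neg hj, if_pos h2]
        · simp only [r, if_neg hj, if_neg h2]
      let L : Fin k → Prop := fun c => ∃ᶠ j in atTop, (m j).1 = c ∧ x j ∈ N c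
      have hL : ∀ c, L c → L (c + 1) := by
        intro c hc
        refine frequently_atTop.2 fun a => ?_
        obtain ⟨j, hj, hjc, hjN⟩ := frequently_atTop.1 hc a
        have hex : ∃ n, x (j + 1 + n) ∈ N (m (j + 1 + n)).1 := by
          obtain ⟨n, hn, hn'⟩ := frequently_atTop.1 hfr (j + 1)
          refine ⟨n - (j + 1), ?_⟩
          rwa [show j + 1 + (n - (j + 1)) = n by omega]
        have hmode : ∀ n ≤ Nat.find hex, (m (j + 1 + n)).1 = c + 1 := by
          intro n
          induction n with
          | zero =>
            intro _
            have := hstep j (by rw [hjc]; exact hjN)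
            rw [hjc] at this
            exact this
          | succ n ih =>
            intro hn
            have := hstay (j + 1 + n) (Nat.find_min hex (by omega))
            rw [ih (by omega)] at this
            exact this
        have h1 := hmode _ le_rfl
        have h2 := Nat.find_spec hex
        rw [h1] at h2
        exact ⟨j + 1 + Nat.find hex, by omega, h1, h2⟩
      have hex : ∃ c, L c := by
        by_contra hcon
        have h1 : ∀ᶠ j in atTop, ∀ c, ¬ ((m j).1 = c ∧ x j ∈ N c) := by
          rw [eventually_all]
          intro c
          by_contra h
          exact hcon ⟨c, h⟩
        exact hfr (h1.mono fun j hj hN => hj _ ⟨rfl, hN⟩)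
      obtain ⟨c₀, hc₀⟩ := hex
      have hadd : ∀ n : ℕ, L (c₀ + Fin.ofNat k n) := by
        intro n
        induction n with
        | zero =>
          have : Fin.ofNat k 0 = 0 := rfl
          rwa [this, add_zero]
        | succ n ih =>
          have h1 : Fin.ofNat k (n + 1) = Fin.ofNat k n + 1 := by
            ext
            simp [Fin.val_add]
          rw [h1, ← add_assoc]
          exact hL _ ih
      intro c
      have h1 := hadd (c - c₀).val
      rw [Fin.ofNat_val_eq_self, add_sub_cancel] at h1
      exact h1.mono fun j hj => hj.2
    · right
      obtain ⟨J, hJ⟩ := eventually_atTop.1 (not_frequently.1 hfr)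
      have hstay : ∀ j, x j ∉ N (m j).1 → (m (j + 1)).1 = (m j).1 := by
        intro j hj
        rw [(hr j).2.2.1]
        by_cases h2 : x j ∈ A (m j).1
        · simp only [r, if_neg hj, if_pos h2]
        · simp only [r, if_neg hj, if_neg h2]
      set c := (m J).1 with hc
      have hmode : ∀ n, (m (J + n)).1 = c := by
        intro n
        induction n with
        | zero => rfl
        | succ n ih => rw [← ih]; exact hstay _ (hJ _ (Nat.le_add_right _ _))
      have hN : ∀ n, x (J + n) ∉ N c := fun n => by
        have := hJ (J + n) (by omega)
        rwa [hmode n] at this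
      have hnA : ∀ n, x (J + n) ∉ A c := by
        intro n hn
        have hstepA : ∀ p, x (J + p) ∈ A c →
            x (J + p + 1) ∈ A c ∧ rk c (x (J + p + 1)) < rk c (x (J + p)) := by
          intro p hp
          by_cases ho : own (x (J + p)) = i
          · rw [(hr (J + p)).2.2.2 ho]
            have hNp : x (J + p) ∉ N (m (J + p)).1 := by rw [hmode p]; exact hN p
            have hAp : x (J + p) ∈ A (m (J + p)).1 := by rw [hmode p]; exact hp
            simp only [r, if_neg hNp, if_pos hAp]
            rw [hmode p]
            exact ((hA c).move _ hp (hN p) ho).2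
          · exact (hA c).opp _ hp (hN p) ho _ (hr _).1 (hr _).2.1
        have hall : ∀ p, x (J + n + p) ∈ A c := by
          intro p
          induction p with
          | zero => exact hn
          | succ p ih =>
            rw [add_assoc] at ih
            have := (hstepA _ ih).1
            rwa [← add_assoc] at this
        obtain ⟨p, hp⟩ := exists_le_succ (fun p => rk c (x (J + n + p)))
        have h1 := hall p
        rw [add_assoc] at h1
        have h2 := (hstepA _ h1).2
        rw [← add_assoc] at h2
        exact absurd h2 (not_lt.2 hp)
      -- The least such position is needed: if it is positive, its predecessor lies in the attractor
      -- of its own mode, so the memory of `s c` has just been initialised.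
      have hex : ∃ J, ∀ n, (m (J + n)).1 = c ∧ x (J + n) ∉ A c := ⟨J, fun n => ⟨hmode n, hnA n⟩⟩
      have hJ₀ := Nat.find_spec hex
      set J₀ := Nat.find hex with hJ₀def
      have hini : (m J₀).2 = (s c).ini (x J₀) := by
        rcases Nat.eq_zero_or_pos J₀ with h | h
        · have h1 := (hJ₀ 0).1
          rw [h] at h1 ⊢
          rw [hm0] at h1 ⊢
          simp only [r] at h1 ⊢
          rw [h1]
        · obtain ⟨l, hl⟩ : ∃ l, J₀ = l + 1 := ⟨J₀ - 1, by omega⟩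
          have h1 := (hJ₀ 0).1
          have hlA : x l ∈ A (m l).1 := by
            by_contra hlA
            refine Nat.find_min hex (show l < J₀ by omega) fun n => ?_
            cases n with
            | zero =>
              have h2 := hstay l fun h => hlA ((hA _).base h)
              rw [add_zero, hl, h2] at h1
              rw [add_zero]
              exact ⟨h1, h1 ▸ hlA⟩
            | succ n =>
              have := hJ₀ n
              rw [hl] at this
              rwa [add_assoc, add_comm 1 n] at this
          rw [add_zero, hl] at h1
          rw [hl]
          rw [(hr l).2.2.1] at h1 ⊢
          by_cases h2 : x l ∈ N (m l).1
          · simp only [r, if_pos h2] at h1 ⊢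
            rw [h1]
          · simp only [r, if_neg h2, if_pos hlA] at h1 ⊢
            rw [h1]
      refine ⟨c, hΦ c x J₀ ((hs c).wins _ (fun j => (m (J₀ + j)).2) (fun j => ?_)
        ⟨(hr _).1, (hJ₀ 0).2⟩ hini)⟩
      obtain ⟨h1, h2, h3, h4⟩ := hr (J₀ + j)
      have hA' : x (J₀ + j) ∉ A (m (J₀ + j)).1 := by rw [(hJ₀ j).1]; exact (hJ₀ j).2
      have hN' : x (J₀ + j) ∉ N (m (J₀ + j)).1 := fun h => hA' ((hA _).base h)
      refine ⟨⟨h1, (hJ₀ j).2⟩, h2, ?_, fun ho => ?_⟩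
      · change (m (J₀ + j + 1)).2 = _
        rw [h3]
        simp only [r, if_neg hA', if_neg hN']
        rw [(hJ₀ j).1]
        rfl
      · rw [← add_assoc, h4 ho]
        simp only [r, if_neg hA', if_neg hN']
        rw [(hJ₀ j).1]

end GraphGame

/-! ### Determinacy and memory of Streett games -/

namespace GraphGame

open Filter

variable {X : Type*} {own : X → Fin 2} {E : X → X → Prop}

theorem frequently_tail (p : ℕ → Prop) (n : ℕ) :
    (∃ᶠ j in atTop, p (n + j)) ↔ ∃ᶠ j in atTop, p j := by
  have h : (∃ᶠ j in map (fun j => j + n) atTop, p j) ↔ ∃ᶠ j in atTop, p (j + n) := frequently_map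
  rw [map_add_atTop_eq_nat] at h
  simp only [add_comm n]
  exact h.symm

/-- The Streett condition for the pairs `(Q c, P c)` with `c ∈ I`. -/
def Streett {ι : Type*} (Q P : ι → Set X) (I : Finset ι) (x : ℕ → X) : Prop :=
  ∀ c ∈ I, (∃ᶠ j in atTop, x j ∈ Q c) → ∃ᶠ j in atTop, x j ∈ P c

theorem streett_tail {ι : Type*} {Q P : ι → Set X} {I : Finset ι} (x : ℕ → X) (n : ℕ) :
    Streett Q P I (fun j => x (n + j)) ↔ Streett Q P I x :=
  forall₂_congr fun c _ => imp_congr (frequently_tail (fun j => x j ∈ Q c) n)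
    (frequently_tail (fun j => x j ∈ P c) n)

variable (own E) in
/-- The subgame `S` with winning condition `Φ` for Player `0` is determined; Player `0` wins with
`K` memory states and Player `1` wins with a positional strategy. -/
def Determined (K : ℕ) (S : Set X) (Φ : (ℕ → X) → Prop) : Prop :=
  ∃ W₀ W₁ : Set X, W₀ ∪ W₁ = S ∧
    (∃ s : MemStrategy X (Fin K), Wins own E 0 s S W₀ Φ) ∧
    ∃ t : MemStrategy X (Fin 1), Wins own E 1 t S W₁ (fun x => ¬ Φ x)

theorem wins_empty {M : Type*} {i : Fin 2} (s : MemStrategy X M) (S : Set X)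
    (Φ : (ℕ → X) → Prop) : Wins own E i s S ∅ Φ :=
  ⟨Set.empty_subset _, fun _ h => absurd h id, fun _ h => absurd h id, fun _ _ _ h => absurd h id⟩

/-- In `S` the opponent has only one new option compared with `S \ A`, namely moving into `A`, where
the play is won anyway. -/
theorem Wins.union_diff {M : Type*} {i : Fin 2} {s t : MemStrategy X M} {S A W : Set X}
    {Φ : (ℕ → X) → Prop} (hA : Wins own E i s S A Φ) (hΦ : ∀ x n, Φ (fun j => x (n + j)) → Φ x)
    (hW : Wins own E i t (S \ A) W Φ) :
    ∃ r : MemStrategy X M, Wins own E i r S (A ∪ W) Φ := by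
  refine hA.union (t := t) hΦ (fun v hv => (hW.subset hv).1)
    (fun v hv ho m => ⟨(hW.move v hv ho m).1, Or.inr (hW.move v hv ho m).2⟩) ?_ ?_
  · intro v hv ho w hw hE
    by_cases hwA : w ∈ A
    · exact Or.inl hwA
    · exact Or.inr (hW.closed v hv ho w ⟨hw, hwA⟩ hE)
  · exact fun x m hr hx hm => hW.wins x m (fun j => ⟨hW.subset (hx j), (hr j).2⟩) (hx 0) hm

theorem ne_zero_iff_eq_one (a : Fin 2) : a ≠ 0 ↔ a = 1 := by omega

theorem ne_one_iff_eq_zero (a : Fin 2) : a ≠ 1 ↔ a = 0 := by omega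

/-- Solving `S \ A` suffices: Player 0 wins on the attractor `A`, and from outside `A` she cannot
move into it, so Player 1's region in `S \ A` remains winning in `S`. The companion
`Determined.of_wins_one` exchanges the roles. -/
theorem Determined.of_wins_zero {K : ℕ} [NeZero K] {S Y A : Set X} {rk : X → ℕ} {f : X → X}
    {Φ : (ℕ → X) → Prop} (hΦ : ∀ x n, Φ (fun j => x (n + j)) ↔ Φ x)
    {s : MemStrategy X (Fin K)} (hY : Wins own E 0 s S Y Φ) (hA : IsAttractor own E 0 S Y A rk f)
    (h : Determined own E K (S \ A) Φ) : Determined own E K S Φ := by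
  obtain ⟨W₀, W₁, hW, ⟨s', hs'⟩, t, ht⟩ := h
  obtain ⟨r, hr⟩ := hY.attractor (fun x n => (hΦ x n).1) hA
  refine ⟨A ∪ W₀, W₁, ?_, hr.union_diff (fun x n => (hΦ x n).1) hs', t,
    ht.lift fun v hv hvA ho => hA.compl_own v hv hvA ((ne_one_iff_eq_zero _).1 ho)⟩
  rw [Set.union_assoc, hW, Set.union_sdiff_self, Set.union_eq_right.2 hA.subset]

theorem Determined.of_wins_one {K : ℕ} {S Y A : Set X} {rk : X → ℕ} {f : X → X}
    {Φ : (ℕ → X) → Prop} (hΦ : ∀ x n, Φ (fun j => x (n + j)) ↔ Φ x)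
    {s : MemStrategy X (Fin 1)} (hY : Wins own E 1 s S Y (fun x => ¬ Φ x))
    (hA : IsAttractor own E 1 S Y A rk f)
    (h : Determined own E K (S \ A) Φ) : Determined own E K S Φ := by
  obtain ⟨W₀, W₁, hW, ⟨s', hs'⟩, t, ht⟩ := h
  obtain ⟨r, hr⟩ := hY.attractor (fun x n => mt (hΦ x n).2) hA
  refine ⟨W₀, A ∪ W₁, ?_,
    ⟨s', hs'.lift fun v hv hvA ho => hA.compl_own v hv hvA ((ne_zero_iff_eq_one _).1 ho)⟩,
    hr.union_diff (fun x n => mt (hΦ x n).2) ht⟩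
  rw [Set.union_left_comm, hW, Set.union_sdiff_self, Set.union_eq_right.2 hA.subset]

theorem IsAttractor.ncard_diff_lt [Finite X] {i : Fin 2} {S Y A : Set X} {rk : X → ℕ} {f : X → X}
    (hA : IsAttractor own E i S Y A rk f) (hY : Y.Nonempty) : (S \ A).ncard < S.ncard := by
  obtain ⟨v, hv⟩ := hY
  exact Set.ncard_lt_ncard ⟨Set.sdiff_subset,
    fun h => (h (hA.subset (hA.base hv))).2 (hA.base hv)⟩ (Set.toFinite S)

variable [Finite X]

/-- Adding a co-Büchi condition to a Streett condition does not increase the memory. -/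
theorem determined_coBuchi {ι : Type*} {Q P : ι → Set X} {I : Finset ι} {K : ℕ} [NeZero K]
    (h : ∀ S, IsSubarena E S → Determined own E K S (Streett Q P I)) (F : Set X) (S : Set X)
    (hS : IsSubarena E S) :
    Determined own E K S (fun x => (¬ ∃ᶠ j in atTop, x j ∈ F) ∧ Streett Q P I x) := by
  induction hn : S.ncard using Nat.strong_induction_on generalizing S with
  | _ n ih =>
  have hΦ : ∀ (x : ℕ → X) (n : ℕ), ((¬ ∃ᶠ j in atTop, x (n + j) ∈ F) ∧
      Streett Q P I (fun j => x (n + j))) ↔ ((¬ ∃ᶠ j in atTop, x j ∈ F) ∧ Streett Q P I x) := by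
    intro x n
    rw [streett_tail, frequently_tail (fun j => x j ∈ F)]
  obtain ⟨A, rk, f, hA⟩ := exists_attractor own E 1 (S := S) (N := S ∩ F) Set.inter_subset_left
  obtain ⟨W₀, W₁, hW, ⟨s, hs⟩, t, ht⟩ := h _ (hS.diff own E hA)
  rcases W₀.eq_empty_or_nonempty with h0 | h0
  · rw [h0, Set.empty_union] at hW
    subst hW
    -- If Player 1 wins the Streett game everywhere outside his attractor of `F`, a single target
    -- suffices: either `F` recurs, or the play eventually stays outside and violates the Streett
    -- condition. The memory is `Fin (1 * 1)`, so the strategy is positional.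
    obtain ⟨r, hr⟩ := exists_roundRobin (k := 1) hS (fun _ => hA) (s := fun _ => t)
      (Φ := fun _ x => ¬ Streett Q P I x) (fun _ => ht) (fun _ x n => mt (streett_tail x n).2)
    refine ⟨∅, S, Set.empty_union _, ⟨s, wins_empty s S _⟩, r, hr.mono ?_⟩
    rintro x - (hx | ⟨-, hx⟩) ⟨h1, h2⟩
    · exact h1 ((hx 0).mono fun j hj => hj.2)
    · exact hx h2
  -- Otherwise `W₀` is a region avoiding `F` that Player 1 cannot leave, even in `S`; remove its
  -- attractor and recurse on the number of vertices.
  · have hs' : Wins own E 0 s S W₀ (fun x => (¬ ∃ᶠ j in atTop, x j ∈ F) ∧ Streett Q P I x) := by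
      refine Wins.lift (hs.mono fun x hx hst => ⟨?_, hst⟩)
        fun v hv hvA ho => hA.compl_own v hv hvA ((ne_zero_iff_eq_one _).1 ho)
      rw [not_frequently]
      exact Eventually.of_forall fun j hj =>
        (hs.subset (hx j)).2 (hA.base ⟨(hs.subset (hx j)).1, hj⟩)
    obtain ⟨A₀, rk₀, f₀, hA₀⟩ := exists_attractor own E 0 hs'.subset
    exact Determined.of_wins_zero hΦ hs' hA₀
      (ih _ (hn ▸ hA₀.ncard_diff_lt h0) _ (hS.diff own E hA₀) rfl)

/-- Streett games are determined; Player `0` needs at most `n!` memory states if there are `n`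
pairs, and Player `1` needs no memory. -/
theorem determined_streett {ι : Type*} (Q P : ι → Set X) (n : ℕ) (I : Finset ι) (hI : I.card = n)
    (S : Set X) (hS : IsSubarena E S) : Determined own E n.factorial S (Streett Q P I) := by
  classical
  induction n generalizing I S with
  | zero =>
    have hg : ∀ v, ∃ w, v ∈ S → w ∈ S ∧ E v w := by
      intro v
      by_cases hv : v ∈ S
      · obtain ⟨w, hw⟩ := hS v hv
        exact ⟨w, fun _ => hw⟩
      · exact ⟨v, fun h => absurd h hv⟩
    choose g hg using hg
    rw [Finset.card_eq_zero] at hI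
    subst hI
    refine ⟨S, ∅, Set.union_empty _, ⟨⟨fun v _ => g v, fun m _ _ => m, fun _ => (0 : Fin 1)⟩,
      subset_rfl, fun v hv _ _ => ⟨(hg v hv).2, (hg v hv).1⟩, fun _ _ _ w hw _ => hw,
      fun _ _ _ _ _ c hc => absurd hc (Finset.notMem_empty c)⟩,
      ⟨fun v _ => g v, fun m _ _ => m, fun _ => (0 : Fin 1)⟩, wins_empty _ _ _⟩
  | succ n ihn =>
    have : NeZero n.factorial := ⟨n.factorial_ne_zero⟩
    induction hm : S.ncard using Nat.strong_induction_on generalizing S with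
    | _ m ih =>
    have hatt := fun c => exists_attractor own E 0 (S := S) (N := S ∩ P c) Set.inter_subset_left
    choose A rk f hA using hatt
    -- Outside `A c` the set `P c` is absent, so pair `c` demands that `Q c` be visited only
    -- finitely often; the remaining `n` pairs are covered by the induction hypothesis.
    have hdet := fun c : I => determined_coBuchi
      (fun S hS => ihn (I.erase c) (by rw [Finset.card_erase_of_mem c.2, hI]; rfl) S hS) (Q c) _
      (hS.diff own E (hA c))
    unfold Determined at hdet
    choose W₀ W₁ hW hs ht using hdet
    choose s hs using hs
    choose t ht using ht
    by_cases hne : ∃ c, (W₁ c).Nonempty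
    -- Player 0 cannot enter `A c` from outside, so Player 1's win in the subgame for `c` persists
    -- in `S`; its attractor is removed.
    · obtain ⟨c, hc⟩ := hne
      have ht' : Wins own E 1 (t c) S (W₁ c) (fun x => ¬ Streett Q P I x) := by
        refine Wins.lift ((ht c).mono fun x hx hnot hst => hnot ?_)
          fun v hv hvA ho => (hA c).compl_own v hv hvA ((ne_one_iff_eq_zero _).1 ho)
        refine ⟨fun hQ => ?_, fun c' hc' => hst c' (Finset.mem_of_mem_erase hc')⟩
        obtain ⟨j, hj⟩ := (hst c c.2 hQ).exists
        have := (ht c).subset (hx j)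
        exact this.2 ((hA c).base ⟨this.1, hj⟩)
      obtain ⟨A₁, rk₁, f₁, hA₁⟩ := exists_attractor own E 1 ht'.subset
      exact Determined.of_wins_one streett_tail ht' hA₁
        (ih _ (hm ▸ hA₁.ncard_diff_lt hc) _ (hS.diff own E hA₁) rfl)
    · push Not at hne
      have hs' : ∀ c, Wins own E 0 (s c) (S \ A c) (S \ A c)
          (fun x => (¬ ∃ᶠ j in atTop, x j ∈ Q c) ∧ Streett Q P (I.erase c) x) := by
        intro c
        have h1 := hW c
        rw [hne c, Set.union_empty] at h1
        have h2 := hs c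
        rwa [h1] at h2
      -- The round robin over `n + 1` targets uses `(n + 1) * n!` states, which is definitionally
      -- `(n + 1)!`.
      let e := (I.equivFinOfCardEq hI).symm
      obtain ⟨r, hr⟩ := exists_roundRobin hS (fun c => hA (e c)) (fun c => hs' (e c)) (by
        intro c x n
        rw [streett_tail, frequently_tail (fun j => x j ∈ Q _)]
        exact id)
      refine ⟨S, ∅, Set.union_empty _, ⟨r, hr.mono ?_⟩,
        ⟨fun v _ => v, fun m _ _ => m, fun _ => (0 : Fin 1)⟩, wins_empty _ _ _⟩
      rintro x - (hx | ⟨c, hx1, hx2⟩) c' hc' hQ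
      · have := hx (e.symm ⟨c', hc'⟩)
        rw [Equiv.apply_symm_apply] at this
        exact this.mono fun j hj => hj.2
      · by_cases hcc : c' = e c
        · subst hcc
          exact absurd hQ hx1
        · exact hx2 c' (Finset.mem_erase.2 ⟨hcc, hc'⟩) hQ

end GraphGame

/-! ### Strategies on words versus memory structures -/

namespace Arena

variable {V : Type*} {A : Arena V} {i : Fin 2}

/-- The memory states reached along the play `ρ`. -/
def memSeq {N : Type*} (n₀ : N) (upd : N → V → V → N) (ρ : ℕ → V) : ℕ → N
  | 0 => n₀
  | j + 1 => upd (memSeq n₀ upd ρ j) (ρ j) (ρ (j + 1))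

theorem map_range_append (ρ : ℕ → V) (j : ℕ) :
    (List.range j).map ρ ++ [ρ j] = (List.range (j + 1)).map ρ := by
  simp [List.range_succ]

theorem Memory.updPlus_map_range {k : ℕ} (M : Memory V k) (ρ : ℕ → V) (j : ℕ) :
    M.updPlus M.init ((List.range j).map ρ ++ [ρ j]) = memSeq M.init M.upd ρ j := by
  induction j with
  | zero => simp [memSeq, updPlus]
  | succ j ih =>
    rw [← map_range_append ρ j, List.append_assoc]
    exact (M.updPlus_append _ _ _ _).trans (by rw [ih]; rfl)

theorem IsPlay.isChain {ρ : ℕ → V} (h : A.IsPlay ρ) (j : ℕ) :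
    ((List.range j).map ρ ++ [ρ j]).IsChain A.Adj := by
  rw [map_range_append, List.isChain_iff_getElem]
  intro n hn
  simp only [List.getElem_map, List.getElem_range]
  exact h.2 n

theorem Strategy.ImplementableWith.exists_memory {σ : A.Strategy i} {k : ℕ}
    (h : σ.ImplementableWith k) :
    ∃ (M : Memory V k) (nxt : V → Fin k → V), ∀ ρ, A.IsPlay ρ → σ.Consistent ρ →
      ∀ j, A.owner (ρ j) = i → ρ (j + 1) = nxt (ρ j) (memSeq M.init M.upd ρ j) := by
  obtain ⟨M, nxt, -, h⟩ := h
  refine ⟨M, nxt, fun ρ hρ hc j ho => ?_⟩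
  rw [hc j ho, h _ _ (hρ.isChain j) ho, M.updPlus_map_range]

theorem Strategy.le_size {σ : A.Strategy i} {K : ℕ} (h : ∀ k, σ.ImplementableWith k → K ≤ k) :
    (K : ℕ∞) ≤ σ.size :=
  le_iInf₂ fun k hk => Nat.cast_le.2 (h k hk)

theorem exists_strategy_of_memory {N : Type*} [Fintype N] (n₀ : N) (upd : N → V → V → N)
    (nxt : V → N → V) (hn : ∀ v n, A.owner v = i → A.Adj v (nxt v n)) :
    ∃ σ : A.Strategy i, σ.size ≤ (Fintype.card N : ℕ∞) ∧ ∀ ρ, σ.Consistent ρ →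
      ∀ j, A.owner (ρ j) = i → ρ (j + 1) = nxt (ρ j) (memSeq n₀ upd ρ j) := by
  let e := Fintype.equivFin N
  let M : Memory V (Fintype.card N) := ⟨e n₀, fun m v w => e (upd (e.symm m) v w)⟩
  let σ : A.Strategy i := ⟨fun w v => nxt v (e.symm (M.updPlus M.init (w ++ [v]))),
    fun w v ho => hn _ _ ho⟩
  have hM : ∀ ρ j, e.symm (memSeq M.init M.upd ρ j) = memSeq n₀ upd ρ j := by
    intro ρ j
    induction j with
    | zero => simp [memSeq, M]
    | succ j ih =>
      simp only [memSeq, ← ih]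
      simp [M]
  refine ⟨σ, iInf₂_le _ ⟨M, fun v m => nxt v (e.symm m), fun v m ho => hn _ _ ho,
    fun _ _ _ _ => rfl⟩, fun ρ hc j ho => ?_⟩
  rw [hc j ho, ← hM, ← M.updPlus_map_range]

/-- Iterating on triples of past word, vertex and opponent's memory lets an arbitrary strategy be
played against an automaton. This gives exclusivity in the determinacy statement and the adversaries
in the lower bounds. -/
theorem exists_consistent_play (σ : A.Strategy i) {N : Type*} (n₀ : N) (upd : N → V → V → N)
    (nxt : V → N → V) (hn : ∀ v n, A.owner v ≠ i → A.Adj v (nxt v n)) :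
    ∃ ρ, A.IsPlay ρ ∧ σ.Consistent ρ ∧
      ∀ j, A.owner (ρ j) ≠ i → ρ (j + 1) = nxt (ρ j) (memSeq n₀ upd ρ j) := by
  let mv : List V × V × N → V := fun s =>
    if A.owner s.2.1 = i then σ.move s.1 s.2.1 else nxt s.2.1 s.2.2
  let step : List V × V × N → List V × V × N := fun s =>
    (s.1 ++ [s.2.1], mv s, upd s.2.2 s.2.1 (mv s))
  let s : ℕ → List V × V × N := fun j => step^[j] ([], A.init, n₀)
  have hs : ∀ j, s (j + 1) = step (s j) := fun j => Function.iterate_succ_apply' _ _ _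
  let ρ : ℕ → V := fun j => (s j).2.1
  have hρ : ∀ j, ρ (j + 1) = mv (s j) := fun j => by simp only [ρ, hs]; rfl
  have h1 : ∀ j, (s j).1 = (List.range j).map ρ := by
    intro j
    induction j with
    | zero => rfl
    | succ j ih => rw [hs, ← map_range_append, ← ih]
  have h2 : ∀ j, (s j).2.2 = memSeq n₀ upd ρ j := by
    intro j
    induction j with
    | zero => rfl
    | succ j ih =>
      rw [memSeq, ← ih, hρ, hs]
  refine ⟨ρ, ⟨rfl, fun j => ?_⟩, fun j ho => ?_, fun j ho => ?_⟩
  · rw [hρ]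
    by_cases ho : A.owner (s j).2.1 = i
    · simp only [mv, if_pos ho]
      exact σ.adj_move _ _ ho
    · simp only [mv, if_neg ho]
      exact hn _ _ ho
  · rw [hρ, ← h1]
    exact if_pos ho
  · rw [hρ, ← h2]
    exact if_neg ho

theorem exists_consistent (σ : A.Strategy i) : ∃ ρ, A.IsPlay ρ ∧ σ.Consistent ρ := by
  choose g hg using A.exists_succ
  obtain ⟨ρ, h1, h2, -⟩ := exists_consistent_play σ () (fun _ _ _ => ()) (fun v _ => g v)
    fun v _ _ => hg v
  exact ⟨ρ, h1, h2⟩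

end Arena

/-! ### Arithmetic of costs, and transport of games along bijections -/

namespace StreettGame

open Filter

variable {V W : Type*} {d : ℕ} {G : StreettGame V d}

theorem stCor_le_iff {ρ : ℕ → V} {j b : ℕ} : G.stCor ρ j ≤ b ↔
    ∀ c, ρ j ∈ G.Q c → ∃ k, j ≤ k ∧ ρ k ∈ G.P c ∧ G.infixCost c ρ j k ≤ b := by
  rw [stCor, iSup_le_iff]
  refine forall_congr' fun c => ?_
  rw [stCorPair]
  by_cases hQ : ρ j ∈ G.Q c
  · rw [if_pos hQ]
    simp only [hQ, forall_true_left]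
    constructor
    · intro h
      by_contra! hcon
      have h1 : ((b + 1 : ℕ) : ℕ∞) ≤
          ⨅ (k : ℕ) (_ : j ≤ k ∧ ρ k ∈ G.P c), (G.infixCost c ρ j k : ℕ∞) :=
        le_iInf₂ fun k hk => Nat.cast_le.2 (hcon k hk.1 hk.2)
      have := Nat.cast_le.1 (h1.trans h)
      omega
    · rintro ⟨k, h1, h2, h3⟩
      exact (iInf₂_le k ⟨h1, h2⟩).trans (Nat.cast_le.2 h3)
  · simp [hQ]

/-- Costs are integral or infinite: a limit superior at most `b` is below `b + 1`, so eventually all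
costs-of-response are below `b + 1`. -/
theorem playCost_le_iff {ρ : ℕ → V} {b : ℕ} :
    G.playCost ρ ≤ b ↔ ∀ᶠ j in atTop, G.stCor ρ j ≤ b := by
  constructor
  · intro h
    have h1 : limsup (fun j => G.stCor ρ j) atTop < ((b + 1 : ℕ) : ℕ∞) :=
      lt_of_le_of_lt h (Nat.cast_lt.2 (Nat.lt_succ_self b))
    refine (eventually_lt_of_limsup_lt h1).mono fun j hj => ?_
    rw [Nat.cast_add_one] at hj
    exact Order.le_of_lt_add_one hj
  · intro h
    exact limsup_le_of_le (by isBoundedDefault) h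

theorem succ_le_playCost_iff {ρ : ℕ → V} {b : ℕ} :
    ((b + 1 : ℕ) : ℕ∞) ≤ G.playCost ρ ↔ ¬ G.playCost ρ ≤ b := by
  rw [not_le, Nat.cast_add_one, ENat.add_one_le_iff (ENat.natCast_ne_top b)]

theorem infixCost_of_isFinitary (hG : G.IsFinitary) {ρ : ℕ → V} (hρ : G.toArena.IsPlay ρ)
    (c : Fin d) (j k : ℕ) : G.infixCost c ρ j k = k - j := by
  rw [infixCost, Finset.sum_congr rfl fun l _ => hG c _ _ (hρ.2 l)]
  simp

variable (G) in
/-- Transport of a game along a bijection of the vertices. -/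
def map (e : V ≃ W) : StreettGame W d where
  owner w := G.owner (e.symm w)
  Adj v w := G.Adj (e.symm v) (e.symm w)
  init := e G.init
  exists_succ v := by
    obtain ⟨w, hw⟩ := G.exists_succ (e.symm v)
    exact ⟨e w, by simpa using hw⟩
  Q c := e.symm ⁻¹' G.Q c
  P c := e.symm ⁻¹' G.P c
  cost c v w := G.cost c (e.symm v) (e.symm w)

theorem map_map_symm (e : V ≃ W) : (G.map e).map e.symm = G := by
  obtain ⟨⟨o, a, i, h⟩, q, p, c⟩ := G
  simp [map, ← Set.preimage_comp]

theorem IsFinitary.map (hG : G.IsFinitary) (e : V ≃ W) : (G.map e).IsFinitary :=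
  fun c _ _ h => hG c _ _ h

theorem playCost_map (e : V ≃ W) (ρ : ℕ → V) : (G.map e).playCost (e ∘ ρ) = G.playCost ρ := by
  have h : ∀ c j, (G.map e).stCorPair c (e ∘ ρ) j = G.stCorPair c ρ j := by
    classical
    intro c j
    unfold stCorPair
    refine if_congr (by simp [map]) ?_ rfl
    simp [infixCost, map]
  simp only [playCost, stCor, h]

/-- Transport of a strategy along a bijection of the vertices. -/
def mapStrategy {i : Fin 2} (σ : G.toArena.Strategy i) (e : V ≃ W) :
    (G.map e).toArena.Strategy i where
  move w v := e (σ.move (w.map e.symm) (e.symm v))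
  adj_move w v ho := by
    have := σ.adj_move (w.map e.symm) (e.symm v) ho
    simpa [map] using this

theorem isPlay_map {e : V ≃ W} {ρ : ℕ → V} :
    (G.map e).toArena.IsPlay (e ∘ ρ) ↔ G.toArena.IsPlay ρ := by
  simp [Arena.IsPlay, map]

theorem consistent_mapStrategy {i : Fin 2} {σ : G.toArena.Strategy i} {e : V ≃ W} {ρ : ℕ → V} :
    (mapStrategy σ e).Consistent (e ∘ ρ) ↔ σ.Consistent ρ := by
  simp [Arena.Strategy.Consistent, map, mapStrategy, Function.comp_def]

theorem cost₀_mapStrategy (σ : G.toArena.Strategy 0) (e : V ≃ W) :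
    (G.map e).cost₀ (mapStrategy σ e) = G.cost₀ σ := by
  refine ((Equiv.refl ℕ).arrowCongr e).surjective.iSup_congr
    (g := fun ρ => ⨆ _, (G.map e).playCost ρ) _ (fun ρ => ?_) |>.symm
  change (⨆ (_ : (G.map e).toArena.IsPlay (e ∘ ρ) ∧ (mapStrategy σ e).Consistent (e ∘ ρ)),
    (G.map e).playCost (e ∘ ρ)) = _
  rw [isPlay_map, consistent_mapStrategy, playCost_map]

theorem cost₁_mapStrategy (σ : G.toArena.Strategy 1) (e : V ≃ W) :
    (G.map e).cost₁ (mapStrategy σ e) = G.cost₁ σ := by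
  refine ((Equiv.refl ℕ).arrowCongr e).surjective.iInf_congr
    (g := fun ρ => ⨅ _, (G.map e).playCost ρ) _ (fun ρ => ?_) |>.symm
  change (⨅ (_ : (G.map e).toArena.IsPlay (e ∘ ρ) ∧ (mapStrategy σ e).Consistent (e ∘ ρ)),
    (G.map e).playCost (e ∘ ρ)) = _
  rw [isPlay_map, consistent_mapStrategy, playCost_map]

theorem implementableWith_mapStrategy {i : Fin 2} {σ : G.toArena.Strategy i} {k : ℕ}
    (h : σ.ImplementableWith k) (e : V ≃ W) : (mapStrategy σ e).ImplementableWith k := by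
  obtain ⟨M, nxt, h1, h2⟩ := h
  refine ⟨⟨M.init, fun m v w => M.upd m (e.symm v) (e.symm w)⟩,
    fun v m => e (nxt (e.symm v) m), fun v m ho => ?_, fun w v hc ho => ?_⟩
  · have := h1 (e.symm v) m ho
    simpa [map] using this
  · have hu : ∀ (m : Fin k) (l : List W),
        Arena.Memory.updPlus ⟨M.init, fun m v w => M.upd m (e.symm v) (e.symm w)⟩ m l =
          M.updPlus m (l.map e.symm) := by
      intro m l
      induction l generalizing m with
      | nil => rfl
      | cons a l ih =>
        cases l with
        | nil => rfl
        | cons a' l => exact ih _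
    have hc' : (w.map e.symm ++ [e.symm v]).IsChain G.Adj := by
      have : (List.map e.symm (w ++ [v])).IsChain G.Adj := 
        List.isChain_map_of_isChain e.symm (fun _ _ h => h) hc
      simpa using this
    rw [hu]
    simp only [mapStrategy, List.map_append, List.map_cons, List.map_nil]
    rw [h2 _ _ hc' ho]

end StreettGame

/-! ### Product of an arena with a memory structure -/

namespace Arena

open GraphGame

variable {V N M : Type*} {A : Arena V} {i : Fin 2}

variable (A) in
/-- The edge relation of the product of an arena and a memory structure. -/
def prodAdj (upd : N → V → V → N) (x y : V × N) : Prop :=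
  A.Adj x.1 y.1 ∧ y.2 = upd x.2 x.1 y.1

theorem isSubarena_prodAdj (upd : N → V → V → N) : IsSubarena (A.prodAdj upd) Set.univ := by
  intro x _
  obtain ⟨w, hw⟩ := A.exists_succ x.1
  exact ⟨(w, upd x.2 x.1 w), trivial, hw, rfl⟩

/-- A winning strategy in the product induces a strategy with memory in the arena. -/
theorem exists_memory_of_wins {upd : N → V → V → N} {n₀ : N} {s : MemStrategy (V × N) M}
    {W : Set (V × N)} {Φ : (ℕ → V × N) → Prop}
    (h : Wins (fun x => A.owner x.1) (A.prodAdj upd) i s Set.univ W Φ) (h0 : (A.init, n₀) ∈ W) :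
    ∃ (m₀ : N × M) (upd' : N × M → V → V → N × M) (nxt : V → N × M → V),
      (∀ v n, A.owner v = i → A.Adj v (nxt v n)) ∧
      ∀ ρ, A.IsPlay ρ → (∀ j, A.owner (ρ j) = i → ρ (j + 1) = nxt (ρ j) (memSeq m₀ upd' ρ j)) →
        Φ (fun j => (ρ j, memSeq n₀ upd ρ j)) := by
  classical
  choose g hg using A.exists_succ
  -- The tracker and the product strategy run in parallel. Outside `W`, `nxt` takes an arbitrary
  -- successor just to remain legal.
  let upd' : N × M → V → V → N × M := fun n v w =>
    (upd n.1 v w, s.upd n.2 (v, n.1) (w, upd n.1 v w))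
  let nxt : V → N × M → V := fun v n => if (v, n.1) ∈ W then (s.nxt (v, n.1) n.2).1 else g v
  let m₀ : N × M := (n₀, s.ini (A.init, n₀))
  refine ⟨m₀, upd', nxt, fun v n ho => ?_, fun ρ hρ hn => ?_⟩
  · by_cases hW : (v, n.1) ∈ W
    · simp only [nxt, if_pos hW]
      exact (h.move _ hW ho _).1.1
    · simp only [nxt, if_neg hW]
      exact hg v
  · have h1 : ∀ j, (memSeq m₀ upd' ρ j).1 = memSeq n₀ upd ρ j := by
      intro j
      induction j with
      | zero => rfl
      | succ j ih => simp only [memSeq, ← ih]; rfl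
    set x : ℕ → V × N := fun j => (ρ j, memSeq n₀ upd ρ j) with hx
    let m : ℕ → M := fun j => (memSeq m₀ upd' ρ j).2
    have hE : ∀ j, A.prodAdj upd (x j) (x (j + 1)) := fun j => ⟨hρ.2 j, rfl⟩
    have hnxt : ∀ j, x j ∈ W → A.owner (x j).1 = i → x (j + 1) = s.nxt (x j) (m j) := by
      intro j hj ho
      have h2 := (h.move _ hj ho (m j)).1
      have h3 : (x (j + 1)).1 = (s.nxt (x j) (m j)).1 := by
        change ρ (j + 1) = _
        rw [hn j ho]
        simp only [nxt, h1]
        rw [if_pos hj]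
      exact Prod.ext h3 (by rw [h2.2, (hE j).2, h3])
    have hW : ∀ j, x j ∈ W := by
      intro j
      induction j with
      | zero =>
        have : x 0 = (A.init, n₀) := by simp [x, hρ.1, memSeq]
        rwa [this]
      | succ j ih =>
        by_cases ho : A.owner (x j).1 = i
        · rw [hnxt j ih ho]
          exact (h.move _ ih ho _).2
        · exact h.closed _ ih ho _ trivial (hE j)
    refine h.wins x m (fun j => ⟨trivial, hE j, ?_, hnxt j (hW j)⟩) (hW 0) ?_
    · change (upd' _ _ _).2 = _
      simp only [upd', h1]
      rfl
    · simp [m, memSeq, m₀, x, hρ.1]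

end Arena

/-! ### The request tracker and the upper bounds -/

namespace StreettGame

open Filter

open Arena GraphGame

variable {V : Type*} {d : ℕ} (G : StreettGame V d) (b : ℕ)

open Classical in
/-- The status of the `c`-th pair in the vertex `w`, when no request is open beforehand. -/
noncomputable def freshStatus (c : Fin d) (w : V) : Option (Fin (b + 1)) :=
  if w ∈ G.Q c ∧ w ∉ G.P c then some 0 else none

open Classical in
/-- The status of the `c`-th pair after traversing an edge: the cost that has been accumulated
since the oldest open request; this request is discarded when its cost exceeds `b`. -/
noncomputable def nextStatus (c : Fin d) (r : Option (Fin (b + 1))) (v w : V) :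
    Option (Fin (b + 1)) :=
  match r with
  | none => G.freshStatus b c w
  | some t =>
    if h : t + G.cost c v w ≤ b then
      if w ∈ G.P c then none else some ⟨t + G.cost c v w, Nat.lt_succ_of_le h⟩
    else G.freshStatus b c w

/-- The cost of an open request of the `c`-th pair exceeds `b` at the given edge. -/
def Overflows (c : Fin d) (r : Option (Fin (b + 1))) (v w : V) : Prop :=
  ∃ t, r = some t ∧ b < t + G.cost c v w

open Classical in
/-- Track the status of all pairs, and whether an overflow has just occurred. -/
noncomputable def track (n : (Fin d → Option (Fin (b + 1))) × Bool) (v w : V) :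
    (Fin d → Option (Fin (b + 1))) × Bool :=
  (fun c => G.nextStatus b c (n.1 c) v w, decide (∃ c, G.Overflows b c (n.1 c) v w))

/-- The initial value of the tracker. -/
noncomputable def trackInit : (Fin d → Option (Fin (b + 1))) × Bool :=
  (fun c => G.freshStatus b c G.init, false)

/-- The sequence of statuses of the `c`-th pair. -/
noncomputable def status (ρ : ℕ → V) (j : ℕ) (c : Fin d) : Option (Fin (b + 1)) :=
  (memSeq (G.trackInit b) (G.track b) ρ j).1 c

variable {G b}

theorem status_zero {ρ : ℕ → V} (hρ : G.toArena.IsPlay ρ) (c : Fin d) :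
    G.status b ρ 0 c = G.freshStatus b c (ρ 0) := by
  rw [hρ.1]
  rfl

theorem status_succ (ρ : ℕ → V) (j : ℕ) (c : Fin d) :
    G.status b ρ (j + 1) c = G.nextStatus b c (G.status b ρ j c) (ρ j) (ρ (j + 1)) := rfl

theorem infixCost_self (c : Fin d) (ρ : ℕ → V) (j : ℕ) : G.infixCost c ρ j j = 0 := by
  simp [infixCost]

theorem infixCost_succ (c : Fin d) (ρ : ℕ → V) {j k : ℕ} (h : j ≤ k) :
    G.infixCost c ρ j (k + 1) = G.infixCost c ρ j k + G.cost c (ρ k) (ρ (k + 1)) :=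
  Finset.sum_Ico_succ_top h _

theorem infixCost_mono (c : Fin d) (ρ : ℕ → V) {j k l : ℕ} (h : k ≤ l) :
    G.infixCost c ρ j k ≤ G.infixCost c ρ j l :=
  Finset.sum_le_sum_of_subset (Finset.Ico_subset_Ico_right h)

theorem exists_request_of_freshStatus {ρ : ℕ → V} {c : Fin d} {a j : ℕ} (haj : a ≤ j)
    {t : Fin (b + 1)} (h : G.freshStatus b c (ρ j) = some t) :
    ∃ l, a ≤ l ∧ l ≤ j ∧ ρ l ∈ G.Q c ∧ G.infixCost c ρ l j = t ∧
      ∀ p, l ≤ p → p ≤ j → ρ p ∉ G.P c := by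
  unfold freshStatus at h
  split_ifs at h with hQ
  cases h
  refine ⟨j, haj, le_rfl, hQ.1, infixCost_self _ _ _, fun p h1 h2 => ?_⟩
  rw [le_antisymm h2 h1]
  exact hQ.2

/-- If the tracker is fresh at `a`, every later counter value is the true cost of a request made at
or after `a` and still open. Applied just after an overflow, this excludes requests from the distant
past. -/
theorem exists_request_of_status {ρ : ℕ → V} {c : Fin d} {a : ℕ}
    (ha : G.status b ρ a c = G.freshStatus b c (ρ a)) {j : ℕ} (haj : a ≤ j) {t : Fin (b + 1)}
    (h : G.status b ρ j c = some t) :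
    ∃ l, a ≤ l ∧ l ≤ j ∧ ρ l ∈ G.Q c ∧ G.infixCost c ρ l j = t ∧
      ∀ p, l ≤ p → p ≤ j → ρ p ∉ G.P c := by
  induction j, haj using Nat.le_induction generalizing t with
  | base => exact exists_request_of_freshStatus le_rfl (ha ▸ h)
  | succ j haj ih =>
    rw [status_succ] at h
    cases hs : G.status b ρ j c with
    | none =>
      rw [hs] at h
      exact exists_request_of_freshStatus (by omega) h
    | some t' =>
      rw [hs] at h
      simp only [nextStatus] at h
      split_ifs at h with h1 h2
      · cases h
        obtain ⟨l, h3, h4, h5, h6, h7⟩ := ih hs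
        refine ⟨l, h3, by omega, h5, by rw [infixCost_succ c ρ h4, h6], fun p hp hp' => ?_⟩
        rcases Nat.lt_or_ge j p with hlt | hge
        · rwa [show p = j + 1 by omega]
        · exact h7 p hp hge
      · exact exists_request_of_freshStatus (by omega) h

theorem status_of_request {ρ : ℕ → V} (hρ : G.toArena.IsPlay ρ) {c : Fin d} {j : ℕ}
    (hQ : ρ j ∈ G.Q c) (hP : ρ j ∉ G.P c) : ∃ t, G.status b ρ j c = some t := by
  have hf : G.freshStatus b c (ρ j) = some 0 := if_pos ⟨hQ, hP⟩
  cases j with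
  | zero => exact ⟨0, (status_zero hρ c).trans hf⟩
  | succ j =>
    rw [status_succ]
    cases G.status b ρ j c with
    | none => exact ⟨0, hf⟩
    | some t =>
      simp only [nextStatus]
      split_ifs with h1
      · exact ⟨_, rfl⟩
      · exact ⟨0, hf⟩

theorem status_of_not_overflows {ρ : ℕ → V} {c : Fin d} {j : ℕ} {t : Fin (b + 1)}
    (h : G.status b ρ j c = some t)
    (ho : ¬ G.Overflows b c (G.status b ρ j c) (ρ j) (ρ (j + 1))) (hP : ρ (j + 1) ∉ G.P c) :
    ∃ t' : Fin (b + 1), G.status b ρ (j + 1) c = some t' ∧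
      (t' : ℕ) = t + G.cost c (ρ j) (ρ (j + 1)) := by
  have h1 : t + G.cost c (ρ j) (ρ (j + 1)) ≤ b := not_lt.1 fun h1 => ho ⟨t, h, h1⟩
  rw [status_succ, h]
  simp only [nextStatus, dif_pos h1, if_neg hP]
  exact ⟨_, rfl, rfl⟩

theorem status_of_overflows {ρ : ℕ → V} {c : Fin d} {j : ℕ}
    (ho : G.Overflows b c (G.status b ρ j c) (ρ j) (ρ (j + 1))) :
    G.status b ρ (j + 1) c = G.freshStatus b c (ρ (j + 1)) := by
  obtain ⟨t, h, h1⟩ := ho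
  rw [status_succ, h]
  simp only [nextStatus, dif_neg (not_le.2 h1)]

/-- Overflows witness costs above `b`; conversely, without overflows the counter dominates the cost
of every open request of its pair, and the Streett condition makes sure that requests are answered.
-/
theorem playCost_le_iff_track {ρ : ℕ → V} (hρ : G.toArena.IsPlay ρ) :
    G.playCost ρ ≤ b ↔
      (¬ ∃ᶠ j in atTop, (memSeq (G.trackInit b) (G.track b) ρ j).2 = true) ∧
      ∀ c, (∃ᶠ j in atTop, ρ j ∈ G.Q c) → ∃ᶠ j in atTop, ρ j ∈ G.P c := by
  classical
  have hflag : ∀ j, (memSeq (G.trackInit b) (G.track b) ρ (j + 1)).2 = true ↔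
      ∃ c, G.Overflows b c (G.status b ρ j c) (ρ j) (ρ (j + 1)) := fun j => decide_eq_true_iff
  rw [playCost_le_iff]
  simp only [stCor_le_iff]
  constructor
  · intro h
    obtain ⟨J, hJ⟩ := eventually_atTop.1 h
    refine ⟨fun hfr => ?_, fun c hQ => frequently_atTop.2 fun a => ?_⟩
    · have hc : ∃ c, ∃ᶠ j in atTop, G.Overflows b c (G.status b ρ j c) (ρ j) (ρ (j + 1)) := by
        by_contra hcon
        have h1 : ∀ᶠ j in atTop, ∀ c,
            ¬ G.Overflows b c (G.status b ρ j c) (ρ j) (ρ (j + 1)) := by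
          rw [eventually_all]
          intro c
          by_contra h
          exact hcon ⟨c, h⟩
        refine (frequently_tail _ 1).2 hfr (h1.mono fun j hj hj' => ?_)
        change (memSeq (G.trackInit b) (G.track b) ρ (1 + j)).2 = true at hj'
        rw [Nat.add_comm 1 j, hflag] at hj'
        obtain ⟨c, hc⟩ := hj'
        exact hj c hc
      obtain ⟨c, hc⟩ := hc
      -- Two overflows past `J` are used: the first resets the tracker, so the second stems from a
      -- request made after `J`.
      obtain ⟨a, ha, ho⟩ := frequently_atTop.1 hc J
      obtain ⟨j, hj, t, ht, hlt⟩ := frequently_atTop.1 hc (a + 1)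
      obtain ⟨l, h1, h2, h3, h4, h5⟩ := exists_request_of_status (status_of_overflows ho) hj ht
      obtain ⟨k, h6, h7, h8⟩ := hJ l (by omega) c h3
      have hjk : j + 1 ≤ k := by
        by_contra hcon
        exact h5 k h6 (by omega) h7
      have h9 := infixCost_mono (G := G) c ρ (j := l) hjk
      rw [infixCost_succ c ρ h2, h4] at h9
      omega
    · obtain ⟨j, hj, hjQ⟩ := frequently_atTop.1 hQ (max a J)
      obtain ⟨k, h1, h2, -⟩ := hJ j (le_trans (le_max_right _ _) hj) c hjQ
      exact ⟨k, le_trans (le_trans (le_max_left _ _) hj) h1, h2⟩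
  · rintro ⟨hfl, hst⟩
    obtain ⟨J, hJ⟩ := eventually_atTop.1 (not_frequently.1 hfl)
    have hno : ∀ j, J ≤ j → ∀ c, ¬ G.Overflows b c (G.status b ρ j c) (ρ j) (ρ (j + 1)) :=
      fun j hj c hc => hJ (j + 1) (by omega) ((hflag j).2 ⟨c, hc⟩)
    rw [eventually_all]
    intro c
    by_cases hQ : ∃ᶠ j in atTop, ρ j ∈ G.Q c
    · have hP := frequently_atTop.1 (hst c hQ)
      refine eventually_atTop.2 ⟨J, fun j hj hjQ => ?_⟩
      have hex : ∃ n, ρ (j + n) ∈ G.P c := by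
        obtain ⟨k, hk, hkP⟩ := hP j
        exact ⟨k - j, by rwa [Nat.add_sub_cancel' hk]⟩
      refine ⟨j + Nat.find hex, by omega, Nat.find_spec hex, ?_⟩
      -- The counter may belong to a request older than `j`, hence only an inequality.
      have hind : ∀ n, n < Nat.find hex →
          ∃ t : Fin (b + 1), G.status b ρ (j + n) c = some t ∧ G.infixCost c ρ j (j + n) ≤ t := by
        intro n
        induction n with
        | zero =>
          intro hn
          obtain ⟨t, ht⟩ := status_of_request (b := b) hρ hjQ (Nat.find_min hex hn)
          exact ⟨t, ht, by rw [add_zero, infixCost_self]; exact Nat.zero_le _⟩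
        | succ n ih =>
          intro hn
          obtain ⟨t, ht, hle⟩ := ih (by omega)
          obtain ⟨t', ht', hle'⟩ := status_of_not_overflows ht (hno _ (by omega) c)
            (Nat.find_min hex hn)
          refine ⟨t', ht', ?_⟩
          rw [← add_assoc, infixCost_succ c ρ (Nat.le_add_right j n)]
          omega
      cases hn : Nat.find hex with
      | zero => rw [add_zero, infixCost_self]; exact Nat.zero_le _
      | succ n =>
        obtain ⟨t, ht, hle⟩ := hind n (by omega)
        have := hno (j + n) (by omega) c
        rw [← add_assoc, infixCost_succ c ρ (Nat.le_add_right j n)]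
        by_contra hcon
        exact this ⟨t, ht, by omega⟩
    · exact (not_frequently.1 hQ).mono fun j h1 h2 => absurd h2 h1

theorem exists_positional_strategy (A : Arena V) (i : Fin 2) : ∃ τ : A.Strategy i, τ.size ≤ 1 := by
  choose g hg using A.exists_succ
  obtain ⟨τ, hτ, -⟩ := exists_strategy_of_memory (i := i) () (fun _ _ _ => ()) (fun v _ => g v)
    fun v _ _ => hg v
  exact ⟨τ, by simpa using hτ⟩

variable [Fintype V]

theorem card_track (d b : ℕ) :
    Fintype.card ((Fin d → Option (Fin (b + 1))) × Bool) = (b + 2) ^ d * 2 := by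
  simp

variable (G b) in
/-- Either Player `0` can bound the cost by `b`, or Player `1` can enforce a cost exceeding `b`. -/
theorem threshold_determined :
    ((∃ σ : G.toArena.Strategy 0, G.cost₀ σ ≤ b ∧
        σ.size ≤ (((b + 2) ^ d * 2 * d.factorial : ℕ) : ℕ∞)) ∧
      ∀ τ : G.toArena.Strategy 1, ¬ ((b + 1 : ℕ) : ℕ∞) ≤ G.cost₁ τ) ∨
    ((∃ τ : G.toArena.Strategy 1, ((b + 1 : ℕ) : ℕ∞) ≤ G.cost₁ τ ∧
        τ.size ≤ (((b + 2) ^ d * 2 : ℕ) : ℕ∞)) ∧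
      ∀ σ : G.toArena.Strategy 0, ¬ G.cost₀ σ ≤ b) := by
  have : NeZero d.factorial := ⟨d.factorial_ne_zero⟩
  have hsub := G.toArena.isSubarena_prodAdj (G.track b)
  -- The co-Büchi set consists of the product vertices whose flag is raised.
  obtain ⟨W₀, W₁, hW, ⟨s, hs⟩, t, ht⟩ := determined_coBuchi
    (own := fun x => G.owner x.1) (I := Finset.univ)
    (fun S hS => determined_streett (fun c => {x | x.1 ∈ G.Q c}) (fun c => {x | x.1 ∈ G.P c}) d
      (Finset.univ : Finset (Fin d)) (by simp) S hS) {x | x.2.2 = true} Set.univ hsub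
  have hΦ : ∀ ρ, G.toArena.IsPlay ρ → (G.playCost ρ ≤ b ↔
      (¬ ∃ᶠ j in atTop, (memSeq (G.trackInit b) (G.track b) ρ j).2 = true) ∧
      Streett (fun c => {x : V × ((Fin d → Option (Fin (b + 1))) × Bool) | x.1 ∈ G.Q c})
        (fun c => {x | x.1 ∈ G.P c}) Finset.univ
        (fun j => (ρ j, memSeq (G.trackInit b) (G.track b) ρ j))) := by
    intro ρ hρ
    rw [playCost_le_iff_track hρ]
    simp [Streett]
  have h0 : (G.init, G.trackInit b) ∈ W₀ ∪ W₁ := hW ▸ trivial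
  rcases h0 with h0 | h0
  · left
    obtain ⟨m₀, upd, nxt, hleg, hwin⟩ := exists_memory_of_wins hs h0
    constructor
    · obtain ⟨σ, hsize, hσ⟩ := exists_strategy_of_memory m₀ upd nxt hleg
      refine ⟨σ, iSup₂_le fun ρ hρ => (hΦ ρ hρ.1).2 (hwin ρ hρ.1 (hσ ρ hρ.2)), ?_⟩
      rwa [Fintype.card_prod, card_track, Fintype.card_fin] at hsize
    · intro τ hτ
      obtain ⟨ρ, hρ, hc, hn⟩ := exists_consistent_play τ m₀ upd nxt
        fun v n ho => hleg v n ((ne_one_iff_eq_zero _).1 ho)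
      have h1 := (hΦ ρ hρ).2 (hwin ρ hρ fun j ho => hn j ((ne_one_iff_eq_zero _).2 ho))
      exact succ_le_playCost_iff.1 (hτ.trans (iInf₂_le ρ ⟨hρ, hc⟩)) h1
  · right
    obtain ⟨m₀, upd, nxt, hleg, hwin⟩ := exists_memory_of_wins ht h0
    constructor
    · obtain ⟨τ, hsize, hτ⟩ := exists_strategy_of_memory m₀ upd nxt hleg
      refine ⟨τ, le_iInf₂ fun ρ hρ => succ_le_playCost_iff.2 fun h =>
        hwin ρ hρ.1 (hτ ρ hρ.2) ((hΦ ρ hρ.1).1 h), ?_⟩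
      rwa [Fintype.card_prod, card_track, Fintype.card_fin, mul_one] at hsize
    · intro σ hσ
      obtain ⟨ρ, hρ, hc, hn⟩ := exists_consistent_play σ m₀ upd nxt
        fun v n ho => hleg v n ((ne_zero_iff_eq_one _).1 ho)
      exact hwin ρ hρ (fun j ho => hn j ((ne_zero_iff_eq_one _).2 ho))
        ((hΦ ρ hρ).1 ((le_iSup₂ (f := fun ρ _ => G.playCost ρ) ρ ⟨hρ, hc⟩).trans hσ))

theorem exists_small_strategy₀ (hd : 1 ≤ d) (h : ∃ σ : G.toArena.Strategy 0, G.cost₀ σ ≤ b) :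
    ∃ σ : G.toArena.Strategy 0, G.cost₀ σ ≤ b ∧
      σ.size ≤ (((d + 1).factorial * (b + 2) ^ d : ℕ) : ℕ∞) := by
  obtain ⟨σ, hσ⟩ := h
  rcases G.threshold_determined b with ⟨⟨σ', h1, h2⟩, -⟩ | ⟨-, h⟩
  · refine ⟨σ', h1, h2.trans (Nat.cast_le.2 ?_)⟩
    rw [Nat.factorial_succ]
    calc (b + 2) ^ d * 2 * d.factorial = 2 * d.factorial * (b + 2) ^ d := by ring
      _ ≤ (d + 1) * d.factorial * (b + 2) ^ d := by gcongr; omega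
  · exact absurd hσ (h σ)

/-- With `b = a + 1`, the threshold `a` gives `(a + 2) ^ d * 2` states, which fits once there are
two vertices. For `b = 0` every strategy works, and with one vertex there is only one play; a
strategy of size 1 then suffices. -/
theorem exists_small_strategy₁ (h : ∃ τ : G.toArena.Strategy 1, (b : ℕ∞) ≤ G.cost₁ τ) :
    ∃ τ : G.toArena.Strategy 1, (b : ℕ∞) ≤ G.cost₁ τ ∧
      τ.size ≤ ((Fintype.card V * (b + 2) ^ d : ℕ) : ℕ∞) := by
  obtain ⟨τ, hτ⟩ := h
  have hV : 1 ≤ Fintype.card V := Fintype.card_pos_iff.2 ⟨G.init⟩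
  obtain ⟨τ₁, hτ₁⟩ := exists_positional_strategy G.toArena 1
  have hone : (1 : ℕ∞) ≤ ((Fintype.card V * (b + 2) ^ d : ℕ) : ℕ∞) := by
    rw [Nat.one_le_cast]
    exact Nat.mul_pos hV (by positivity)
  rcases Nat.eq_zero_or_pos b with rfl | hb
  · exact ⟨τ₁, by simp, hτ₁.trans hone⟩
  obtain ⟨a, rfl⟩ : ∃ a, b = a + 1 := ⟨b - 1, by omega⟩
  rcases hV.eq_or_lt with hV1 | hV2
  · have : Subsingleton V := Fintype.card_le_one_iff_subsingleton.1 hV1.symm.le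
    obtain ⟨ρ, hρ⟩ := exists_consistent τ
    refine ⟨τ₁, le_iInf₂ fun ρ' _ => ?_, hτ₁.trans hone⟩
    rw [Subsingleton.elim ρ' ρ]
    exact hτ.trans (iInf₂_le ρ hρ)
  · rcases G.threshold_determined a with ⟨-, h⟩ | ⟨⟨τ', h1, h2⟩, -⟩
    · exact absurd hτ (h τ)
    · refine ⟨τ', h1, h2.trans (Nat.cast_le.2 ?_)⟩
      rw [mul_comm]
      gcongr <;> omega

end StreettGame

/-! ### The detour game: cost of a round -/

namespace StreettGame

open Filter

open Arena

/-- At least one detour of each index is forced by the first `D` pairs, and at most `D` detours in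
total are allowed by the last pair: hence exactly one per index. -/
theorem forall_eq_not_iff (D : ℕ) (x y : ℕ → Bool) :
    ((∀ c < D, x c = true ∨ y c = true) ∧
      ∑ c ∈ Finset.range D, ((x c).toNat + (y c).toNat) ≤ D) ↔ ∀ c < D, y c = !x c := by
  have hone : ∑ c ∈ Finset.range D, 1 = D := by simp
  constructor
  · rintro ⟨h1, h2⟩ c hc
    have hle : ∀ c ∈ Finset.range D, 1 ≤ (x c).toNat + (y c).toNat := by
      intro c hc
      have := h1 c (Finset.mem_range.1 hc)
      rcases this with h | h <;> rw [h] <;> simp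
    have heq := (Finset.sum_eq_sum_iff_of_le hle).1
      (le_antisymm (Finset.sum_le_sum hle) (by rwa [hone])) c (Finset.mem_range.2 hc)
    revert heq
    cases x c <;> cases y c <;> simp
  · intro h
    refine ⟨fun c hc => ?_, ?_⟩
    · rw [h c hc]
      cases x c <;> simp
    · calc ∑ c ∈ Finset.range D, ((x c).toNat + (y c).toNat) = ∑ c ∈ Finset.range D, 1 :=
            Finset.sum_congr rfl fun c hc => by
              rw [h c (Finset.mem_range.1 hc)]
              cases x c <;> rfl
        _ ≤ D := hone.le

/-- The positions on the cycle at which a detour is possible; at the first `D` of them, Player `1`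
chooses whether to take the detour, at the other ones, Player `0` does. -/
def CanDetour (D p : ℕ) : Prop := (D + 1 ≤ p ∧ p < 2 * D + 1) ∨ (2 * D + 2 ≤ p ∧ p < 3 * D + 2)

/-- A cycle of length `n + 1` with detours. In each round, all pairs are requested at position `0`.
The last pair is answered at position `n`, and the `c`-th one by taking the `c`-th detour of
Player `1` or the `c`-th detour of Player `0`. -/
def detourGame (D n : ℕ) : StreettGame (Fin (n + 1) × Bool) (D + 1) where
  owner v := if v.1 < 2 * D + 2 then 1 else 0
  Adj v w := w = (v.1 + 1, false) ∨ (v.2 = false ∧ CanDetour D v.1 ∧ w = (v.1, true))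
  init := (0, false)
  exists_succ _ := ⟨_, Or.inl rfl⟩
  Q _ := {v | v = (0, false)}
  P c := {v | (v.2 = true ∧ c < D ∧ ((v.1 : ℕ) = D + 1 + c ∨ (v.1 : ℕ) = 2 * D + 2 + c)) ∨
    ((c : ℕ) = D ∧ (v.1 : ℕ) = n)}
  cost _ _ _ := 1

theorem detourGame_isFinitary (D n : ℕ) : (detourGame D n).IsFinitary := fun _ _ _ _ => rfl

section Detours

variable {n : ℕ}

/-- The time at which a play of the detour game leaves the first `j` positions (counting from the
beginning of the play). -/
def arrival (ρ : ℕ → Fin (n + 1) × Bool) : ℕ → ℕ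
  | 0 => 0
  | j + 1 => arrival ρ j + 1 + (ρ (arrival ρ j + 1)).2.toNat

/-- The `j`-th detour is taken. -/
def detour (ρ : ℕ → Fin (n + 1) × Bool) (j : ℕ) : Bool := (ρ (arrival ρ j + 1)).2

/-- The position on the cycle reached after `j` positions. -/
def pos (n j : ℕ) : Fin (n + 1) := Fin.ofNat (n + 1) j

theorem pos_succ (j : ℕ) : pos n (j + 1) = pos n j + 1 := by
  ext
  simp [pos, Fin.val_add]

theorem val_pos (j : ℕ) : (pos n j : ℕ) = j % (n + 1) := rfl

theorem val_pos_add {r i : ℕ} (hi : i ≤ n) : (pos n (r * (n + 1) + i) : ℕ) = i := by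
  rw [val_pos, mul_comm, Nat.mul_add_mod, Nat.mod_eq_of_lt (Nat.lt_succ_of_le hi)]

/-- A visit to position `p` from round `r` on belongs either to round `r` or to a later one. -/
theorem eq_or_le_of_pos {r j p : ℕ} (hj : r * (n + 1) ≤ j) (hp : (pos n j : ℕ) = p) :
    j = r * (n + 1) + p ∨ (r + 1) * (n + 1) + p ≤ j := by
  rw [val_pos] at hp
  have h1 := Nat.div_add_mod j (n + 1)
  have h2 : r ≤ j / (n + 1) := (Nat.le_div_iff_mul_le (Nat.succ_pos n)).2 hj
  rw [hp, mul_comm] at h1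
  rcases h2.eq_or_lt with h | h
  · left
    rw [h, h1]
  · right
    have := Nat.mul_le_mul_right (n + 1) (show r + 1 ≤ j / (n + 1) from h)
    omega

theorem arrival_succ (ρ : ℕ → Fin (n + 1) × Bool) (j : ℕ) :
    arrival ρ (j + 1) = arrival ρ j + 1 + (detour ρ j).toNat := rfl

theorem arrival_strictMono (ρ : ℕ → Fin (n + 1) × Bool) : StrictMono (arrival ρ) :=
  strictMono_nat_of_lt_succ fun j => by rw [arrival_succ]; omega

theorem arrival_add (ρ : ℕ → Fin (n + 1) × Bool) (a m : ℕ) :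
    arrival ρ (a + m) = arrival ρ a + m + ∑ i ∈ Finset.range m, (detour ρ (a + i)).toNat := by
  induction m with
  | zero => simp
  | succ m ih =>
    rw [← add_assoc, arrival_succ, ih, Finset.sum_range_succ]
    omega

theorem exists_arrival (ρ : ℕ → Fin (n + 1) × Bool) (t : ℕ) :
    ∃ j, t = arrival ρ j ∨ (detour ρ j = true ∧ t = arrival ρ j + 1) := by
  induction t with
  | zero => exact ⟨0, Or.inl rfl⟩
  | succ t ih =>
    obtain ⟨j, h | ⟨h1, h2⟩⟩ := ih
    · cases hd : detour ρ j with
      | false => exact ⟨j + 1, Or.inl (by rw [arrival_succ, hd, h]; rfl)⟩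
      | true => exact ⟨j, Or.inr ⟨hd, by rw [h]⟩⟩
    · exact ⟨j + 1, Or.inl (by rw [arrival_succ, h1, h2]; rfl)⟩

variable {D : ℕ} {ρ : ℕ → Fin (n + 1) × Bool}

theorem apply_arrival
    (hρ : (detourGame D n).toArena.IsPlay ρ) (j : ℕ) : ρ (arrival ρ j) = (pos n j, false) := by
  induction j with
  | zero => exact hρ.1
  | succ j ih =>
    rw [arrival_succ, pos_succ]
    have h1 := hρ.2 (arrival ρ j)
    rw [ih] at h1
    rcases h1 with h1 | ⟨-, -, h1⟩
    · have : detour ρ j = false := by rw [detour, h1]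
      rw [this]
      exact h1
    · have : detour ρ j = true := by rw [detour, h1]
      rw [this]
      have h2 := hρ.2 (arrival ρ j + 1)
      rw [h1] at h2
      rcases h2 with h2 | ⟨h2, -⟩
      · exact h2
      · simp at h2

theorem apply_arrival_succ_of_detour
    (hρ : (detourGame D n).toArena.IsPlay ρ) {j : ℕ} (h : detour ρ j = true) :
    ρ (arrival ρ j + 1) = (pos n j, true) ∧ CanDetour D (pos n j) := by
  have h1 := hρ.2 (arrival ρ j)
  rw [apply_arrival hρ] at h1
  rcases h1 with h1 | ⟨-, h2, h1⟩
  · rw [detour, h1] at h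
    simp at h
  · exact ⟨h1, h2⟩

theorem memSeq_arrival_succ
    (hρ : (detourGame D n).toArena.IsPlay ρ) {N : Type*} (n₀ : N) (upd) (j : ℕ) :
    memSeq n₀ upd ρ (arrival ρ (j + 1)) =
      if detour ρ j then
        upd (upd (memSeq n₀ upd ρ (arrival ρ j)) (pos n j, false) (pos n j, true))
          (pos n j, true) (pos n (j + 1), false)
      else upd (memSeq n₀ upd ρ (arrival ρ j)) (pos n j, false) (pos n (j + 1), false) := by
  have h1 := apply_arrival hρ j
  have h2 := apply_arrival hρ (j + 1)
  rw [arrival_succ] at h2 ⊢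
  cases hd : detour ρ j with
  | false =>
    rw [hd] at h2
    simp only [Bool.toNat_false, add_zero] at h2 ⊢
    rw [memSeq, h1, h2]
    simp
  | true =>
    rw [hd] at h2
    simp only [Bool.toNat_true] at h2 ⊢
    rw [memSeq, memSeq, h1, h2, (apply_arrival_succ_of_detour hρ hd).1]
    simp

theorem detour_eq_false
    (hρ : (detourGame D n).toArena.IsPlay ρ) {j : ℕ} (h : ¬ CanDetour D (pos n j)) :
    detour ρ j = false := by
  cases hd : detour ρ j with
  | false => rfl
  | true => exact absurd (apply_arrival_succ_of_detour hρ hd).2 h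

theorem arrival_round
    (hρ : (detourGame D n).toArena.IsPlay ρ) (hn : 3 * D + 2 ≤ n) (r : ℕ) :
    arrival ρ (r * (n + 1) + n) = arrival ρ (r * (n + 1)) + n +
      ∑ c ∈ Finset.range D, ((detour ρ (r * (n + 1) + (D + 1 + c))).toNat +
      (detour ρ (r * (n + 1) + (2 * D + 2 + c))).toNat) := by
  rw [arrival_add]
  congr 1
  have h0 : ∀ i ≤ n, ¬ CanDetour D i → (detour ρ (r * (n + 1) + i)).toNat = 0 := by
    intro i hi hc
    rw [detour_eq_false hρ (by rwa [val_pos_add hi])]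
    rfl
  obtain ⟨e, rfl⟩ := Nat.exists_eq_add_of_le hn
  have h1 : 3 * D + 2 + e = D + 1 + D + 1 + D + e := by ring
  rw [Finset.sum_congr (by rw [h1]) fun _ _ => rfl, Finset.sum_range_add, Finset.sum_range_add,
    Finset.sum_range_succ, Finset.sum_range_add, Finset.sum_add_distrib]
  rw [Finset.sum_eq_zero (s := Finset.range (D + 1)), Finset.sum_eq_zero (s := Finset.range e),
    h0 (D + 1 + D)]
  · rw [show D + 1 + D + 1 = 2 * D + 2 by ring]
    omega
  · omega
  · rintro (h | h) <;> omega
  · intro i hi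
    rw [Finset.mem_range] at hi
    refine h0 _ (by omega) ?_
    rintro (h | h) <;> omega
  · intro i hi
    rw [Finset.mem_range] at hi
    refine h0 _ (by omega) ?_
    rintro (h | h) <;> omega

theorem le_of_mem_P_last
    (hρ : (detourGame D n).toArena.IsPlay ρ) {r k : ℕ} (hk : arrival ρ (r * (n + 1)) ≤ k)
    (hP : ρ k ∈ (detourGame D n).P (Fin.last D)) : arrival ρ (r * (n + 1) + n) ≤ k := by
  have hpos : ((ρ k).1 : ℕ) = n := by
    rcases hP with h | h
    · exact absurd h.2.1 (lt_irrefl _)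
    · exact h.2
  have main : ∀ j, arrival ρ j ≤ k → k < arrival ρ (j + 1) → (pos n j : ℕ) = n →
      arrival ρ (r * (n + 1) + n) ≤ k := by
    intro j h1 h2 h3
    have h4 : r * (n + 1) ≤ j :=
      Nat.le_of_lt_succ ((arrival_strictMono ρ).lt_iff_lt.1 (hk.trans_lt h2))
    refine ((arrival_strictMono ρ).monotone ?_).trans h1
    rcases eq_or_le_of_pos h4 h3 with h | h
    · exact h.ge
    · rw [add_mul] at h
      omega
  obtain ⟨j, h | ⟨h1, h2⟩⟩ := exists_arrival ρ k
  · rw [h, apply_arrival hρ] at hpos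
    exact main j h.ge (h.trans_lt ((arrival_strictMono ρ) (Nat.lt_succ_self j))) hpos
  · rw [h2, (apply_arrival_succ_of_detour hρ h1).1] at hpos
    refine main j (by omega) ?_ hpos
    rw [arrival_succ, h1, h2]
    simp

theorem detour_of_mem_P
    (hρ : (detourGame D n).toArena.IsPlay ρ) {r k c : ℕ} (hc : c < D)
    (hk : arrival ρ (r * (n + 1)) ≤ k) (hP : ρ k ∈ (detourGame D n).P ⟨c, by omega⟩)
    (hle : k - arrival ρ (r * (n + 1)) ≤ n + D) :
    detour ρ (r * (n + 1) + (D + 1 + c)) = true ∨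
      detour ρ (r * (n + 1) + (2 * D + 2 + c)) = true := by
  obtain ⟨hP1, -, hP2⟩ := hP.resolve_right fun h => hc.ne h.1
  obtain ⟨j, h | ⟨h1, h2⟩⟩ := exists_arrival ρ k
  · rw [h, apply_arrival hρ] at hP1
    simp at hP1
  · rw [h2, (apply_arrival_succ_of_detour hρ h1).1] at hP2
    have h4 : r * (n + 1) ≤ j := by
      by_contra hcon
      have h5 : arrival ρ (j + 1) ≤ arrival ρ (r * (n + 1)) :=
        (arrival_strictMono ρ).monotone (by omega)
      rw [arrival_succ, h1, Bool.toNat_true] at h5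
      omega
    -- The initial stretch of `D + 1` positions puts the detours of the next round out of reach
    -- within cost `n + D`.
    have main : ∀ p, D + 1 + c ≤ p → (pos n j : ℕ) = p → j = r * (n + 1) + p := by
      intro p hp hjp
      refine (eq_or_le_of_pos h4 hjp).resolve_right fun h5 => ?_
      have h6 := (arrival_strictMono ρ).monotone h5
      rw [add_mul, add_assoc, arrival_add] at h6
      omega
    simp only at hP2
    rcases hP2 with h5 | h5
    · left
      rw [← main _ le_rfl h5]
      exact h1
    · right
      rw [← main _ (by omega) h5]
      exact h1

theorem stCor_arrival_le_iff
    (hρ : (detourGame D n).toArena.IsPlay ρ) (hn : 3 * D + 2 ≤ n) (r : ℕ) :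
    (detourGame D n).stCor ρ (arrival ρ (r * (n + 1))) ≤ ((n + D : ℕ) : ℕ∞) ↔
      ∀ c < D, detour ρ (r * (n + 1) + (2 * D + 2 + c)) =
        !detour ρ (r * (n + 1) + (D + 1 + c)) := by
  have hstart : ρ (arrival ρ (r * (n + 1))) = (0, false) := by
    rw [apply_arrival hρ]
    ext <;> simp [pos]
  have hround := arrival_round hρ hn r
  rw [stCor_le_iff, ← forall_eq_not_iff D (fun c => detour ρ (r * (n + 1) + (D + 1 + c)))
    (fun c => detour ρ (r * (n + 1) + (2 * D + 2 + c)))]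
  simp only [infixCost_of_isFinitary (detourGame_isFinitary D n) hρ]
  constructor
  · intro h
    refine ⟨fun c hc => ?_, ?_⟩
    · obtain ⟨k, h1, h2, h3⟩ := h ⟨c, by omega⟩ hstart
      exact detour_of_mem_P hρ hc h1 h2 h3
    · obtain ⟨k, h1, h2, h3⟩ := h (Fin.last D) hstart
      have := le_of_mem_P_last hρ h1 h2
      omega
  · rintro ⟨h1, h2⟩ c -
    rcases Nat.lt_or_ge c D with hc | hc
    · have main : ∀ p, (p = D + 1 + c ∨ p = 2 * D + 2 + c) →
          detour ρ (r * (n + 1) + p) = true → ∃ k, arrival ρ (r * (n + 1)) ≤ k ∧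
            ρ k ∈ (detourGame D n).P c ∧ k - arrival ρ (r * (n + 1)) ≤ n + D := by
        intro p hp hd
        have hpn : p + 1 ≤ n := by omega
        refine ⟨arrival ρ (r * (n + 1) + p) + 1, ?_, ?_, ?_⟩
        · exact ((arrival_strictMono ρ).monotone (Nat.le_add_right _ _)).trans (Nat.le_succ _)
        · rw [(apply_arrival_succ_of_detour hρ hd).1]
          refine Or.inl ⟨rfl, hc, ?_⟩
          simp only
          rwa [val_pos_add (by omega)]
        · have : arrival ρ (r * (n + 1) + p + 1) ≤ arrival ρ (r * (n + 1) + n) :=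
            (arrival_strictMono ρ).monotone (by omega)
          rw [arrival_succ, hd, Bool.toNat_true] at this
          omega
      rcases h1 c hc with h | h
      · exact main _ (Or.inl rfl) h
      · exact main _ (Or.inr rfl) h
    · refine ⟨arrival ρ (r * (n + 1) + n), (arrival_strictMono ρ).monotone (Nat.le_add_right _ _),
        ?_, by omega⟩
      rw [apply_arrival hρ]
      exact Or.inr ⟨by omega, val_pos_add le_rfl⟩

/-- A cheaper round would still take exactly `D` detours, so the last pair costs exactly `n + D`.
Hence no round beats the threshold. -/
theorem le_stCor_arrival
    (hρ : (detourGame D n).toArena.IsPlay ρ) (hn : 3 * D + 2 ≤ n) (r b : ℕ)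
    (h : (detourGame D n).stCor ρ (arrival ρ (r * (n + 1))) ≤ (b : ℕ∞)) : n + D ≤ b := by
  by_contra! hb
  have h1 := (stCor_arrival_le_iff hρ hn r).1 (h.trans (Nat.cast_le.2 hb.le))
  have hstart : ρ (arrival ρ (r * (n + 1))) = (0, false) := by
    rw [apply_arrival hρ]
    ext <;> simp [pos]
  obtain ⟨k, h2, h3, h4⟩ := stCor_le_iff.1 h (Fin.last D) hstart
  rw [infixCost_of_isFinitary (detourGame_isFinitary D n) hρ] at h4
  have h5 := le_of_mem_P_last hρ h2 h3
  rw [arrival_round hρ hn, Finset.sum_congr rfl (g := fun _ => 1)] at h5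
  · simp at h5
    omega
  · intro c hc
    rw [h1 c (Finset.mem_range.1 hc)]
    cases detour ρ (r * (n + 1) + (D + 1 + c)) <;> rfl

/-- Requests occur only at `(0, false)`, that is, at the starts of rounds. -/
theorem detourGame_playCost_le_iff
    (hρ : (detourGame D n).toArena.IsPlay ρ) (hn : 3 * D + 2 ≤ n) :
    (detourGame D n).playCost ρ ≤ ((n + D : ℕ) : ℕ∞) ↔
      ∀ᶠ r in atTop, ∀ c < D, detour ρ (r * (n + 1) + (2 * D + 2 + c)) =
        !detour ρ (r * (n + 1) + (D + 1 + c)) := by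
  have hmono : StrictMono fun r => arrival ρ (r * (n + 1)) :=
    (arrival_strictMono ρ).comp fun a b h => Nat.mul_lt_mul_of_pos_right h (Nat.succ_pos n)
  rw [playCost_le_iff]
  simp only [← stCor_arrival_le_iff hρ hn]
  constructor
  · exact fun h => hmono.tendsto_atTop.eventually h
  · intro h
    obtain ⟨R, hR⟩ := eventually_atTop.1 h
    refine eventually_atTop.2 ⟨arrival ρ (R * (n + 1)), fun t ht => ?_⟩
    by_cases h0 : ρ t = (0, false)
    · obtain ⟨j, h | ⟨h1, h2⟩⟩ := exists_arrival ρ t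
      · rw [h, apply_arrival hρ] at h0
        have h3 : (pos n j : ℕ) = 0 := by rw [(Prod.mk.inj h0).1]; rfl
        rw [h] at ht ⊢
        obtain ⟨q, hq⟩ := Nat.dvd_of_mod_eq_zero h3
        rw [mul_comm] at hq
        subst hq
        exact hR q (Nat.le_of_mul_le_mul_right ((arrival_strictMono ρ).le_iff_le.1 ht)
          (Nat.succ_pos n))
      · rw [h2, (apply_arrival_succ_of_detour hρ h1).1] at h0
        simp at h0
    · exact stCor_le_iff.2 fun c hc => absurd hc h0

end Detours

end StreettGame

/-! ### The lower bound for Player 0 -/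

namespace StreettGame

open Filter

open Arena

section Detours

variable {D n : ℕ}

theorem pos_ne_pos {i j : ℕ} (h1 : i < j) (h2 : j ≤ i + n) : pos n i ≠ pos n j := by
  intro h
  have h3 : i % (n + 1) = j % (n + 1) := congrArg Fin.val h
  have h4 := (Nat.modEq_iff_dvd' h1.le).1 h3
  have := Nat.le_of_dvd (by omega) h4
  omega

/-- Record which detours have been taken most recently. -/
def recordDetours (S : Fin (n + 1) → Bool) (_ w : Fin (n + 1) × Bool) : Fin (n + 1) → Bool :=
  Function.update S w.1 w.2

/-- Arriving at `(pos n i, false)` clears the entry, the detour vertex sets it, and the position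
does not recur within the next `n` positions. -/
theorem memSeq_recordDetours {ρ : ℕ → Fin (n + 1) × Bool}
    (hρ : (detourGame D n).toArena.IsPlay ρ) {i j : ℕ} (h1 : i + 1 ≤ j) (h2 : j ≤ i + n) :
    memSeq (fun _ => false) recordDetours ρ (arrival ρ j) (pos n i) = detour ρ i := by
  induction j, h1 using Nat.le_induction with
  | base =>
    have h3 : memSeq (fun _ => false) recordDetours ρ (arrival ρ i) (pos n i) = false := by
      cases i with
      | zero => rfl
      | succ i =>
        rw [memSeq_arrival_succ hρ]
        split_ifs <;> simp [recordDetours]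
    have h4 := pos_ne_pos (n := n) (Nat.lt_succ_self i) h2
    rw [memSeq_arrival_succ hρ]
    cases hd : detour ρ i <;> simp [recordDetours, h4, h3]
  | succ j h1 ih =>
    have h4 := pos_ne_pos (n := n) (show i < j from h1) (by omega)
    have h5 := pos_ne_pos (n := n) (show i < j + 1 by omega) h2
    rw [← ih (by omega), memSeq_arrival_succ hρ]
    split_ifs <;> simp [recordDetours, h4, h5]

theorem exists_strategy_detourGame (hn : 3 * D + 2 ≤ n) :
    ∃ σ : (detourGame D n).toArena.Strategy 0, (detourGame D n).cost₀ σ = ((n + D : ℕ) : ℕ∞) := by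
  classical
  -- Player 0's `c`-th detour lies `D + 1` positions after Player 1's `c`-th one; it is taken
  -- exactly if that one was skipped.
  let nxt : Fin (n + 1) × Bool → (Fin (n + 1) → Bool) → Fin (n + 1) × Bool := fun v S =>
    if v.2 = false ∧ CanDetour D v.1 ∧ S (pos n (v.1 - (D + 1))) = false then (v.1, true)
    else (v.1 + 1, false)
  obtain ⟨σ, -, hσ⟩ := exists_strategy_of_memory (A := (detourGame D n).toArena) (i := 0)
    (fun _ => false) recordDetours nxt (by
      intro v S _
      by_cases h : v.2 = false ∧ CanDetour D v.1 ∧ S (pos n (v.1 - (D + 1))) = false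
      · simp only [nxt, if_pos h]
        exact Or.inr ⟨h.1, h.2.1, rfl⟩
      · simp only [nxt, if_neg h]
        exact Or.inl rfl)
  refine ⟨σ, le_antisymm (iSup₂_le fun ρ hρ => ?_) ?_⟩
  · refine (detourGame_playCost_le_iff hρ.1 hn).2 (Eventually.of_forall fun r c hc => ?_)
    have hpos : (pos n (r * (n + 1) + (2 * D + 2 + c)) : ℕ) = 2 * D + 2 + c :=
      val_pos_add (by omega)
    have hcan : CanDetour D (2 * D + 2 + c) := Or.inr ⟨by omega, by omega⟩
    have h1 := hσ ρ hρ.2 (arrival ρ (r * (n + 1) + (2 * D + 2 + c))) (by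
      rw [apply_arrival hρ.1]
      change (if _ then (1 : Fin 2) else 0) = 0
      rw [if_neg]
      simp only [hpos]
      omega)
    rw [apply_arrival hρ.1] at h1
    have h2 : pos n ((pos n (r * (n + 1) + (2 * D + 2 + c)) : ℕ) - (D + 1)) =
        pos n (r * (n + 1) + (D + 1 + c)) := by
      ext
      rw [hpos, val_pos_add (by omega), val_pos, Nat.mod_eq_of_lt (by omega)]
      omega
    have h3 := memSeq_recordDetours hρ.1 (i := r * (n + 1) + (D + 1 + c))
      (j := r * (n + 1) + (2 * D + 2 + c)) (by omega) (by omega)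
    rw [detour, h1]
    simp only [nxt]
    rw [h2, h3, hpos]
    cases detour ρ (r * (n + 1) + (D + 1 + c)) <;> simp [hcan]
  · obtain ⟨ρ, hρ⟩ := exists_consistent σ
    refine le_trans ?_ (le_iSup₂ (f := fun ρ _ => (detourGame D n).playCost ρ) ρ hρ)
    have hmono : StrictMono fun r => arrival ρ (r * (n + 1)) :=
      (arrival_strictMono ρ).comp fun a b h => Nat.mul_lt_mul_of_pos_right h (Nat.succ_pos n)
    rw [show n + D = n + D - 1 + 1 by omega, succ_le_playCost_iff, playCost_le_iff]
    intro h
    obtain ⟨r, hr⟩ := (hmono.tendsto_atTop.eventually h).exists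
    have := le_stCor_arrival hρ.1 hn r _ hr
    omega

theorem two_pow_le_of_detourGame (hn : 3 * D + 2 ≤ n) (σ : (detourGame D n).toArena.Strategy 0)
    (hσ : (detourGame D n).cost₀ σ ≤ ((n + D : ℕ) : ℕ∞)) {k : ℕ} (hk : σ.ImplementableWith k) :
    2 ^ D ≤ k := by
  classical
  by_contra! hlt
  obtain ⟨M, nxt, hM⟩ := hk.exists_memory
  -- the memory state after passing a position
  let pass : ℕ → Fin k → Bool → Fin k := fun j m a =>
    if a then M.upd (M.upd m (pos n j, false) (pos n j, true)) (pos n j, true)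
      (pos n (j + 1), false)
    else M.upd m (pos n j, false) (pos n (j + 1), false)
  let plan : (Fin D → Bool) → ℕ → Bool := fun S i =>
    if h : D + 1 ≤ i ∧ i < 2 * D + 1 then S ⟨i - (D + 1), by omega⟩ else false
  let chosen : (Fin D → Bool) → Fin k → ℕ → Fin k := fun S m i =>
    Nat.rec m (fun i m => pass i m (plan S i)) i
  let resp : ℕ → Fin k → Bool := fun j m => (nxt (pos n j, false) m).2
  let answer : Fin k → ℕ → Fin k := fun m i =>
    Nat.rec m (fun i m => pass (2 * D + 2 + i) m (resp (2 * D + 2 + i) m)) i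
  -- Correct answers to all `S` would make `S` recoverable from the memory state reached at position
  -- `2 * D + 2`, an injection into `Fin k`.
  have hbad : ∀ m, ∃ S : Fin D → Bool, ∃ c : Fin D,
      resp (2 * D + 2 + c) (answer (chosen S m (2 * D + 2)) c) ≠ !S c := by
    intro m
    by_contra! hcon
    have hinj : Function.Injective fun S => chosen S m (2 * D + 2) := by
      intro S S' h
      funext c
      have h1 := hcon S c
      have h2 := hcon S' c
      simp only at h
      rw [h, h2] at h1
      simpa using h1.symm
    have := Fintype.card_le_of_injective _ hinj
    simp at this
    omega
  choose bad c hbad using hbad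
  -- The adversary simulates `M` and retains in the second component the state of `M` at the start
  -- of the round, which selects the bad choices.
  let upd : Fin k × Fin k → Fin (n + 1) × Bool → Fin (n + 1) × Bool → Fin k × Fin k :=
    fun m v w => (M.upd m.1 v w, if w = (0, false) then M.upd m.1 v w else m.2)
  obtain ⟨ρ, hρ, hc, hopp⟩ := exists_consistent_play σ (M.init, M.init) upd
    (fun v m => if v.2 = false ∧ CanDetour D v.1 ∧ plan (bad m.2) v.1 = true then (v.1, true)
      else (v.1 + 1, false)) (by
        intro v m _
        by_cases h : v.2 = false ∧ CanDetour D v.1 ∧ plan (bad m.2) v.1 = true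
        · rw [if_pos h]
          exact Or.inr ⟨h.1, h.2.1, rfl⟩
        · rw [if_neg h]
          exact Or.inl rfl)
  have hfst : ∀ j, (memSeq (M.init, M.init) upd ρ j).1 = memSeq M.init M.upd ρ j := by
    intro j
    induction j with
    | zero => rfl
    | succ j ih => rw [memSeq, memSeq, ← ih]
  let mem : ℕ → Fin k := fun j => memSeq M.init M.upd ρ (arrival ρ j)
  have hmem : ∀ j, mem (j + 1) = pass j (mem j) (detour ρ j) := fun j =>
    memSeq_arrival_succ hρ _ _ _
  have hstart : ∀ r, (memSeq (M.init, M.init) upd ρ (arrival ρ (r * (n + 1)))).2 =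
      mem (r * (n + 1)) := by
    intro r
    have h0 : pos n (r * (n + 1)) = 0 := by ext; simp [pos]
    cases hj : r * (n + 1) with
    | zero => rfl
    | succ j =>
      simp only [mem]
      rw [← hfst, memSeq_arrival_succ hρ, ← hj, h0]
      split_ifs <;> simp [upd]
  have hsnd : ∀ r i, i ≤ n →
      (memSeq (M.init, M.init) upd ρ (arrival ρ (r * (n + 1) + i))).2 = mem (r * (n + 1)) := by
    intro r i hi
    induction i with
    | zero => exact hstart r
    | succ i ih =>
      have h1 : pos n (r * (n + 1) + i + 1) ≠ 0 := by
        intro h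
        have h2 := val_pos_add (n := n) (r := r) hi
        rw [← add_assoc, h] at h2
        exact absurd h2 (by simp)
      rw [← ih (by omega), ← add_assoc, memSeq_arrival_succ hρ]
      split_ifs <;> simp [upd, h1]
  have hchoose : ∀ r i, i < 2 * D + 2 → detour ρ (r * (n + 1) + i) =
      plan (bad (mem (r * (n + 1)))) i := by
    intro r i hi
    have hpos : (pos n (r * (n + 1) + i) : ℕ) = i := val_pos_add (by omega)
    have h1 := hopp (arrival ρ (r * (n + 1) + i)) (by
      rw [apply_arrival hρ]
      change (if _ then (1 : Fin 2) else 0) ≠ 0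
      rw [if_pos (by simpa [hpos] using hi)]
      exact one_ne_zero)
    rw [apply_arrival hρ, hsnd r i (by omega)] at h1
    rw [detour, h1]
    simp only [hpos]
    cases hp : plan (bad (mem (r * (n + 1)))) i with
    | false => simp
    | true =>
      have : CanDetour D i := by
        by_contra hcon
        simp only [plan] at hp
        split_ifs at hp with h
        exact hcon (Or.inl h)
      simp [this]
  have hanswer : ∀ r i, i < D → detour ρ (r * (n + 1) + (2 * D + 2 + i)) =
      resp (2 * D + 2 + i) (mem (r * (n + 1) + (2 * D + 2 + i))) := by
    intro r i hi
    have hpos : (pos n (r * (n + 1) + (2 * D + 2 + i)) : ℕ) = 2 * D + 2 + i :=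
      val_pos_add (by omega)
    have h1 := hM ρ hρ hc (arrival ρ (r * (n + 1) + (2 * D + 2 + i))) (by
      rw [apply_arrival hρ]
      change (if _ then (1 : Fin 2) else 0) = 0
      rw [if_neg]
      simp only [hpos]
      omega)
    rw [apply_arrival hρ] at h1
    have h2 : pos n (r * (n + 1) + (2 * D + 2 + i)) = pos n (2 * D + 2 + i) := by
      ext
      rw [hpos, val_pos, Nat.mod_eq_of_lt (by omega)]
    rw [detour, h1, h2]
  have hpass : ∀ r i, i ≤ n → ∀ m a, pass (r * (n + 1) + i) m a = pass i m a := by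
    intro r i hi m a
    have h2 : pos n (r * (n + 1) + i) = pos n i := by
      ext
      rw [val_pos_add hi, val_pos, Nat.mod_eq_of_lt (by omega)]
    simp only [pass, pos_succ, h2]
  have hmem1 : ∀ r i, i ≤ 2 * D + 2 → mem (r * (n + 1) + i) =
      chosen (bad (mem (r * (n + 1)))) (mem (r * (n + 1))) i := by
    intro r i
    induction i with
    | zero => exact fun _ => rfl
    | succ i ih =>
      intro hi
      rw [← add_assoc, hmem, hpass r i (by omega), hchoose r i (by omega), ih (by omega)]
  have hmem2 : ∀ r i, i ≤ D → mem (r * (n + 1) + (2 * D + 2 + i)) =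
      answer (mem (r * (n + 1) + (2 * D + 2))) i := by
    intro r i
    induction i with
    | zero => exact fun _ => rfl
    | succ i ih =>
      intro hi
      rw [← add_assoc, ← add_assoc, hmem, add_assoc, hpass r _ (by omega), hanswer r i (by omega),
        ih (by omega)]
  have hcost := (detourGame_playCost_le_iff hρ hn).1
    ((le_iSup₂ (f := fun ρ _ => (detourGame D n).playCost ρ) ρ ⟨hρ, hc⟩).trans hσ)
  obtain ⟨r, hr⟩ := hcost.exists
  set m := mem (r * (n + 1))
  refine hbad m ?_
  have h1 := hr (c m) (c m).2
  rw [hanswer r _ (c m).2, hmem2 r _ (c m).2.le, hmem1 r _ le_rfl,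
    hchoose r _ (by omega)] at h1
  rw [h1]
  simp only [plan]
  rw [dif_pos ⟨by omega, by omega⟩]
  congr 2
  ext
  simp

end Detours

/-- Games on arbitrary finite vertex sets can be replaced by games on `Fin n`. -/
theorem exists_fin_game₀ {V : Type*} [Fintype V] {d b K : ℕ} (G : StreettGame V d)
    (hG : G.IsFinitary) (h1 : ∃ σ : G.toArena.Strategy 0, G.cost₀ σ = (b : ℕ∞))
    (h2 : ∀ σ : G.toArena.Strategy 0, G.cost₀ σ ≤ b → ∀ k, σ.ImplementableWith k → K ≤ k) :
    ∃ G' : StreettGame (Fin (Fintype.card V)) d, G'.IsFinitary ∧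
      (∃ σ : G'.toArena.Strategy 0, G'.cost₀ σ = (b : ℕ∞)) ∧
      ∀ σ : G'.toArena.Strategy 0, G'.cost₀ σ ≤ b → (K : ℕ∞) ≤ σ.size := by
  let e := Fintype.equivFin V
  obtain ⟨σ, hσ⟩ := h1
  refine ⟨G.map e, hG.map e, ⟨mapStrategy σ e, by rw [cost₀_mapStrategy, hσ]⟩,
    fun σ' hσ' => Strategy.le_size fun k hk => ?_⟩
  rw [← map_map_symm (G := G) e] at h2
  exact h2 (mapStrategy σ' e.symm) (by rwa [cost₀_mapStrategy]) k
    (implementableWith_mapStrategy hk e.symm)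

theorem exists_fin_game₁ {V : Type*} [Fintype V] {d b K : ℕ} (G : StreettGame V d)
    (hG : G.IsFinitary) (h1 : ∃ τ : G.toArena.Strategy 1, G.cost₁ τ = (b : ℕ∞))
    (h2 : ∀ τ : G.toArena.Strategy 1, (b : ℕ∞) ≤ G.cost₁ τ → ∀ k, τ.ImplementableWith k → K ≤ k) :
    ∃ G' : StreettGame (Fin (Fintype.card V)) d, G'.IsFinitary ∧
      (∃ τ : G'.toArena.Strategy 1, G'.cost₁ τ = (b : ℕ∞)) ∧
      ∀ τ : G'.toArena.Strategy 1, (b : ℕ∞) ≤ G'.cost₁ τ → (K : ℕ∞) ≤ τ.size := by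
  let e := Fintype.equivFin V
  obtain ⟨σ, hσ⟩ := h1
  refine ⟨G.map e, hG.map e, ⟨mapStrategy σ e, by rw [cost₁_mapStrategy, hσ]⟩,
    fun σ' hσ' => Strategy.le_size fun k hk => ?_⟩
  rw [← map_map_symm (G := G) e] at h2
  exact h2 (mapStrategy σ' e.symm) (by rwa [cost₁_mapStrategy]) k
    (implementableWith_mapStrategy hk e.symm)

theorem exists_lower_bound₀ : ∃ C : ℕ, ∀ d : ℕ, 1 ≤ d → ∃ (n : ℕ) (G : StreettGame (Fin n) d),
    n ≤ C * d ^ 2 ∧ G.IsFinitary ∧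
    (∃ σ : G.toArena.Strategy 0, G.cost₀ σ = ((d ^ 2 + 2 * d : ℕ) : ℕ∞)) ∧
    ∀ σ : G.toArena.Strategy 0, G.cost₀ σ ≤ ((d ^ 2 + 2 * d : ℕ) : ℕ∞) →
      ((2 ^ (d - 1) : ℕ) : ℕ∞) ≤ σ.size := by
  refine ⟨8, fun d hd => ?_⟩
  obtain ⟨D, rfl⟩ : ∃ D, d = D + 1 := ⟨d - 1, by omega⟩
  -- Chosen so that the threshold `n + D` equals `(D + 1) ^ 2 + 2 * (D + 1)`.
  let n := D ^ 2 + 3 * D + 3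
  have hb : (D + 1) ^ 2 + 2 * (D + 1) = n + D := by ring
  have hn : 3 * D + 2 ≤ n := by
    simp only [n]
    omega
  obtain ⟨G, h1, h2, h3⟩ := exists_fin_game₀ (detourGame D n) (detourGame_isFinitary D n)
    (exists_strategy_detourGame hn) (fun σ hσ k hk => two_pow_le_of_detourGame hn σ hσ hk)
  refine ⟨_, G, ?_, h1, ?_, ?_⟩
  · simp only [Fintype.card_prod, Fintype.card_fin, Fintype.card_bool, n]
    nlinarith
  · rwa [hb]
  · rwa [hb, Nat.add_sub_cancel]

end StreettGame

/-! ### The recall game and the lower bound for Player 1 -/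

namespace StreettGame

open Filter

open Arena

/-- The vertices of the recall game. -/
inductive RecallVertex (d B : ℕ) : Type
  | base (t : Fin (B + 1))
  | bit (i : Fin d) (a : Fin 2)
  | query (i : Fin d)
  | reply (i : Fin d) (a : Fin 2)

namespace RecallVertex

variable {d B : ℕ}

/-- The vertices of the recall game as a sum type. -/
def equivSum (d B : ℕ) :
    (Fin (B + 1) ⊕ (Fin d × Fin 2)) ⊕ (Fin d ⊕ (Fin d × Fin 2)) ≃ RecallVertex d B where
  toFun
    | .inl (.inl t) => base t
    | .inl (.inr p) => bit p.1 p.2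
    | .inr (.inl i) => query i
    | .inr (.inr p) => reply p.1 p.2
  invFun
    | base t => .inl (.inl t)
    | bit i a => .inl (.inr (i, a))
    | query i => .inr (.inl i)
    | reply i a => .inr (.inr (i, a))
  left_inv := by rintro ((_ | _) | (_ | _)) <;> rfl
  right_inv := by rintro (_ | _ | _ | _) <;> rfl

noncomputable instance : Fintype (RecallVertex d B) := Fintype.ofEquiv _ (equivSum d B)

theorem card_eq (d B : ℕ) : Fintype.card (RecallVertex d B) = B + 1 + d * 2 + (d + d * 2) := by
  rw [← Fintype.card_congr (equivSum d B)]
  simp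

/-- The successor of a vertex that is determined by an index and a bit. -/
def next [NeZero d] (v : RecallVertex d B) (i : Fin d) (a : Fin 2) : RecallVertex d B :=
  match v with
  | base t => if t = 0 then bit 0 a else if (t : ℕ) = d + 1 then query i else base (t + 1)
  | bit j _ => if h : (j : ℕ) + 1 < d then bit ⟨j + 1, h⟩ a else base (Fin.ofNat _ (d + 1))
  | query j => reply j a
  | reply _ _ => base (Fin.ofNat _ (d + 4))

/-- The time (relative to the beginning of a round) at which a vertex is visited. -/
def time : RecallVertex d B → ℕ
  | base t => t
  | bit i _ => i + 1
  | query _ => d + 2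
  | reply _ _ => d + 3

/-- All rounds have the same length `B + 1`, so a vertex reveals when in the round it is visited.
The bound on `B` keeps the `Fin.ofNat` vertices from wrapping around. -/
theorem time_next [NeZero d] (hB : d + 4 ≤ B) (v : RecallVertex d B) (i : Fin d) (a : Fin 2) :
    (v.next i a).time = (v.time + 1) % (B + 1) := by
  cases v with
  | base t =>
    simp only [next]
    split_ifs with h1 h2
    · subst h1
      simp only [time, Fin.val_zero]
      rw [Nat.mod_eq_of_lt (by omega)]
    · simp only [time, h2]
      rw [Nat.mod_eq_of_lt (by omega)]
    · simp [time, Fin.val_add]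
  | bit j b =>
    simp only [next]
    split_ifs with h
    · simp only [time]
      rw [Nat.mod_eq_of_lt (by omega)]
    · have := j.2
      have h2 : (j : ℕ) + 1 = d := by omega
      simp only [time, h2, Fin.val_ofNat]
  | query j =>
    simp only [next, time]
    rw [Nat.mod_eq_of_lt (by omega)]
  | reply j b => simp [next, time]

end RecallVertex

open RecallVertex

/-- In each round, all pairs are requested, then Player `0` picks `d` bits, each answering one of
two pairs, and an index; Player `1` replies with a bit, which answers all pairs but one. All pairs
are answered at the end of the round. -/
def recallGame (d B : ℕ) [NeZero d] : StreettGame (RecallVertex d B) (2 * d) where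
  owner
    | query _ => 1
    | _ => 0
  Adj v w := ∃ i a, w = v.next i a
  init := base 0
  exists_succ _ := ⟨_, 0, 0, rfl⟩
  Q _ := {base 0}
  P c := {v | v = base (Fin.last B) ∨
    v = bit (finProdFinEquiv.symm c).2 (finProdFinEquiv.symm c).1 ∨
    ∃ i a, v = reply i a ∧ (i = (finProdFinEquiv.symm c).2 → a = (finProdFinEquiv.symm c).1)}
  cost _ _ _ := 1

theorem recallGame_isFinitary {d B : ℕ} [NeZero d] : (recallGame d B).IsFinitary :=
  fun _ _ _ _ => rfl

section Rounds

variable {d B : ℕ} [NeZero d] {ρ : ℕ → RecallVertex d B}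

theorem time_eq_mod (hρ : (recallGame d B).toArena.IsPlay ρ) (hB : d + 4 ≤ B) (t : ℕ) :
    (ρ t).time = t % (B + 1) := by
  induction t with
  | zero => rw [hρ.1]; rfl
  | succ t ih =>
    obtain ⟨i, a, h⟩ := hρ.2 t
    rw [h, time_next hB, ih, Nat.mod_add_mod]

/-- The choices `β`, `q`, `a` made in the round starting at time `R`. -/
structure IsRound (ρ : ℕ → RecallVertex d B) (R : ℕ) (β : Fin d → Fin 2) (q : Fin d)
    (a : Fin 2) : Prop where
  start : ρ R = base 0
  bits : ∀ i : Fin d, ρ (R + 1 + i) = bit i (β i)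
  hub : ρ (R + d + 1) = base (Fin.ofNat _ (d + 1))
  query : ρ (R + d + 2) = query q
  reply : ρ (R + d + 3) = reply q a
  last : ρ (R + B) = base (Fin.last B)

theorem exists_isRound_of_start (hρ : (recallGame d B).toArena.IsPlay ρ) (hB : d + 4 ≤ B) {R : ℕ}
    (hR : ρ R = base 0) : (∃ β q a, IsRound ρ R β q a) ∧ ρ (R + B + 1) = base 0 := by
  have hd : 0 < d := Nat.pos_of_neZero d
  have hbits : ∀ l, ∀ h : l < d, ∃ a, ρ (R + 1 + l) = bit ⟨l, h⟩ a := by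
    intro l
    induction l with
    | zero =>
      intro h
      obtain ⟨i, a, h1⟩ := hρ.2 R
      exact ⟨a, by rw [add_zero, h1, hR]; rfl⟩
    | succ l ih =>
      intro h
      obtain ⟨b, hb⟩ := ih (by omega)
      obtain ⟨i, a, h1⟩ := hρ.2 (R + 1 + l)
      rw [hb] at h1
      exact ⟨a, h1.trans (dif_pos h)⟩
  choose β hβ using fun i : Fin d => hbits i i.2
  have hhub : ρ (R + d + 1) = base (Fin.ofNat _ (d + 1)) := by
    obtain ⟨b, hb⟩ := hbits (d - 1) (by omega)
    obtain ⟨i, a, h1⟩ := hρ.2 (R + 1 + (d - 1))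
    rw [hb, show R + 1 + (d - 1) + 1 = R + d + 1 by omega] at h1
    exact h1.trans (dif_neg (by simp only; omega))
  have hval : ((Fin.ofNat (B + 1) (d + 1) : Fin (B + 1)) : ℕ) = d + 1 := by
    rw [Fin.val_ofNat, Nat.mod_eq_of_lt (by omega)]
  obtain ⟨q, a₁, hq⟩ := hρ.2 (R + d + 1)
  rw [hhub] at hq
  have hne : (Fin.ofNat (B + 1) (d + 1) : Fin (B + 1)) ≠ 0 := by
    intro h
    rw [h] at hval
    simp at hval
  replace hq : ρ (R + d + 2) = RecallVertex.query q :=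
    hq.trans ((if_neg hne).trans (if_pos hval))
  obtain ⟨i₂, a, ha⟩ := hρ.2 (R + d + 2)
  rw [hq] at ha
  replace ha : ρ (R + d + 3) = RecallVertex.reply q a := ha
  have htail : ∀ l, d + 4 + l ≤ B → ρ (R + d + 4 + l) = base (Fin.ofNat _ (d + 4 + l)) := by
    intro l
    induction l with
    | zero =>
      intro _
      obtain ⟨i, b, h1⟩ := hρ.2 (R + d + 3)
      rw [ha] at h1
      exact h1
    | succ l ih =>
      intro hl
      obtain ⟨i, b, h1⟩ := hρ.2 (R + d + 4 + l)
      have hv : ((Fin.ofNat (B + 1) (d + 4 + l) : Fin (B + 1)) : ℕ) = d + 4 + l := by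
        rw [Fin.val_ofNat, Nat.mod_eq_of_lt (by omega)]
      rw [ih (by omega)] at h1
      refine h1.trans ((if_neg ?_).trans ((if_neg ?_).trans ?_))
      · intro h
        rw [h, Fin.val_zero] at hv
        omega
      · rw [hv]
        omega
      · congr 1
        ext
        simp [Fin.val_add, add_assoc]
  have hlast : ρ (R + B) = base (Fin.last B) := by
    have := htail (B - (d + 4)) (by omega)
    rw [show R + d + 4 + (B - (d + 4)) = R + B by omega,
      show d + 4 + (B - (d + 4)) = B by omega] at this
    rw [this]
    congr 1
    ext
    simp
  refine ⟨⟨β, q, a, hR, hβ, hhub, hq, ha, hlast⟩, ?_⟩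
  obtain ⟨i, b, h1⟩ := hρ.2 (R + B)
  rw [hlast] at h1
  refine h1.trans ((if_neg ?_).trans ((if_neg ?_).trans ?_))
  · intro h
    have := congrArg Fin.val h
    simp at this
    omega
  · simp only [Fin.val_last]
    omega
  · congr 1
    exact Fin.last_add_one B

theorem exists_isRound (hρ : (recallGame d B).toArena.IsPlay ρ) (hB : d + 4 ≤ B) (r : ℕ) :
    ∃ β q a, IsRound ρ (r * (B + 1)) β q a := by
  refine (exists_isRound_of_start hρ hB ?_).1
  induction r with
  | zero => rw [zero_mul]; exact hρ.1
  | succ r ih =>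
    rw [add_mul, one_mul, ← add_assoc]
    exact (exists_isRound_of_start hρ hB ih).2

theorem eq_of_time {t R l : ℕ} (hρ : (recallGame d B).toArena.IsPlay ρ) (hB : d + 4 ≤ B) {r : ℕ}
    (hR : R = r * (B + 1)) (h1 : R ≤ t) (h2 : t ≤ R + B) (h3 : (ρ t).time = l) : t = R + l := by
  obtain ⟨s, rfl⟩ := Nat.exists_eq_add_of_le h1
  rw [time_eq_mod hρ hB, hR, mul_comm, Nat.mul_add_mod, Nat.mod_eq_of_lt (by omega)] at h3
  rw [h3]

theorem stCor_le_of_isRound (hρ : (recallGame d B).toArena.IsPlay ρ) {R : ℕ} {β : Fin d → Fin 2}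
    {q : Fin d} {a : Fin 2} (h : IsRound ρ R β q a) :
    (recallGame d B).stCor ρ R ≤ (B : ℕ∞) := by
  refine stCor_le_iff.2 fun c _ => ⟨R + B, by omega, Or.inl h.last, ?_⟩
  rw [infixCost_of_isFinitary recallGame_isFinitary hρ]
  omega

/-- The reply `a` to query `q` answers every pair except the one of index `q` with the opposite bit.
That pair has been answered before iff `a ≠ β q`; otherwise it stays open until the end of the
round, at cost `B`. -/
theorem stCor_lt_iff_of_isRound (hρ : (recallGame d B).toArena.IsPlay ρ) (hB : d + 4 ≤ B)
    {r : ℕ} {β : Fin d → Fin 2} {q : Fin d} {a : Fin 2} (h : IsRound ρ (r * (B + 1)) β q a) :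
    (recallGame d B).stCor ρ (r * (B + 1)) ≤ ((B - 1 : ℕ) : ℕ∞) ↔ a ≠ β q := by
  rw [stCor_le_iff]
  simp only [infixCost_of_isFinitary recallGame_isFinitary hρ]
  constructor
  · rintro hc rfl
    -- Addition in `Fin 2` makes `β q + 1` the opposite bit.
    obtain ⟨k, h1, h2, h3⟩ := hc (finProdFinEquiv (β q + 1, q)) h.start
    have hne : β q ≠ β q + 1 := by
      generalize β q = x
      fin_cases x <;> simp
    rcases h2 with h2 | h2 | ⟨i, b, h2, h4⟩
    · have := eq_of_time hρ hB rfl h1 (by omega) (congrArg time h2)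
      simp only [time, Fin.val_last] at this
      omega
    · have h5 := eq_of_time hρ hB rfl h1 (by omega) (congrArg time h2)
      simp only [time, Equiv.symm_apply_apply] at h5 h2
      have h6 := h.bits q
      rw [show r * (B + 1) + 1 + q = k by omega, h2] at h6
      injection h6 with h6 h7
      exact hne h7.symm
    · have h5 := eq_of_time hρ hB rfl h1 (by omega) (congrArg time h2)
      simp only [time, Equiv.symm_apply_apply] at h5 h4
      have h6 := h.reply
      rw [show r * (B + 1) + d + 3 = k by omega, h2] at h6
      injection h6 with h6 h7
      exact hne (h7.symm.trans (h4 h6))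
  · intro hne c _
    by_cases hc : q = (finProdFinEquiv.symm c).2 ∧ a ≠ (finProdFinEquiv.symm c).1
    · obtain ⟨h1, h2⟩ := hc
      refine ⟨r * (B + 1) + 1 + q, by omega, Or.inr (Or.inl ?_), by omega⟩
      rw [h.bits, h1]
      congr 1
      rw [← h1]
      generalize (finProdFinEquiv.symm c).1 = x at h2
      omega
    · refine ⟨r * (B + 1) + d + 3, by omega, Or.inr (Or.inr ⟨q, a, h.reply, fun h1 => ?_⟩),
        by omega⟩
      by_contra h2
      exact hc ⟨h1, h2⟩

theorem playCost_le_of_rounds (hρ : (recallGame d B).toArena.IsPlay ρ) (hB : d + 4 ≤ B) {b : ℕ}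
    {s : ℕ}
    (h : ∀ r, s ≤ r → (recallGame d B).stCor ρ (r * (B + 1)) ≤ (b : ℕ∞)) :
    (recallGame d B).playCost ρ ≤ b := by
  refine playCost_le_iff.2 (eventually_atTop.2 ⟨s * (B + 1), fun t ht => ?_⟩)
  by_cases h0 : ρ t = base 0
  · have h1 := time_eq_mod hρ hB t
    rw [h0] at h1
    obtain ⟨q, rfl⟩ := Nat.dvd_of_mod_eq_zero h1.symm
    rw [mul_comm (B + 1)] at ht ⊢
    exact h q (Nat.le_of_mul_le_mul_right ht (Nat.succ_pos B))
  · exact stCor_le_iff.2 fun c hc => absurd hc h0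

/-- Record the most recent bits. -/
def recordBits (S : Fin d → Fin 2) (_ w : RecallVertex d B) : Fin d → Fin 2 :=
  match w with
  | bit i a => Function.update S i a
  | _ => S

theorem memSeq_recordBits (hρ : (recallGame d B).toArena.IsPlay ρ) (hB : d + 4 ≤ B)
    {r : ℕ} {β : Fin d → Fin 2} {q : Fin d} {a : Fin 2} (h : IsRound ρ (r * (B + 1)) β q a)
    (S : Fin d → Fin 2) (i : Fin d) {l : ℕ} (h1 : i + 1 ≤ l) (h2 : l ≤ B) :
    memSeq S recordBits ρ (r * (B + 1) + l) i = β i := by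
  induction l, h1 using Nat.le_induction with
  | base =>
    rw [← add_assoc, memSeq, add_right_comm, h.bits]
    simp [recordBits]
  | succ l h1 ih =>
    rw [← add_assoc, memSeq]
    cases hw : ρ (r * (B + 1) + l + 1) with
    | bit j b =>
      have h3 := eq_of_time hρ hB (r := r) rfl (by omega) (by omega) (congrArg time hw)
      simp only [time] at h3
      have hij : i ≠ j := by
        rintro rfl
        omega
      simp only [recordBits]
      rw [Function.update_of_ne hij]
      exact ih (by omega)
    | base _ => exact ih (by omega)
    | query _ => exact ih (by omega)
    | reply _ _ => exact ih (by omega)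

theorem exists_strategy_recallGame (hB : d + 4 ≤ B) :
    ∃ τ : (recallGame d B).toArena.Strategy 1, (recallGame d B).cost₁ τ = (B : ℕ∞) := by
  obtain ⟨τ, -, hτ⟩ := exists_strategy_of_memory (A := (recallGame d B).toArena) (i := 1)
    (fun _ : Fin d => (0 : Fin 2)) recordBits
    (fun v S => match v with
      | query q => reply q (S q)
      | v => v.next 0 0) (by
        rintro (t | ⟨i, a⟩ | q | ⟨i, a⟩) S ho
        · exact ⟨0, 0, rfl⟩
        · exact ⟨0, 0, rfl⟩
        · exact ⟨0, S q, rfl⟩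
        · exact ⟨0, 0, rfl⟩)
  have hupper : ∀ ρ, (recallGame d B).toArena.IsPlay ρ → (recallGame d B).playCost ρ ≤ B :=
    fun ρ hρ => playCost_le_of_rounds (s := 0) hρ hB fun r _ => by
      obtain ⟨β, q, a, h⟩ := exists_isRound hρ hB r
      exact stCor_le_of_isRound hρ h
  refine ⟨τ, le_antisymm ?_ (le_iInf₂ fun ρ hρ => ?_)⟩
  · obtain ⟨ρ, hρ⟩ := exists_consistent τ
    exact (iInf₂_le (f := fun ρ _ => (recallGame d B).playCost ρ) ρ hρ).trans (hupper ρ hρ.1)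
  · obtain ⟨hρ, hc⟩ := hρ
    refine le_trans (Nat.cast_le.2 (show B ≤ B - 1 + 1 by omega)) ?_
    rw [succ_le_playCost_iff, playCost_le_iff]
    intro hev
    have hmono : StrictMono fun r => r * (B + 1) :=
      fun a b h => Nat.mul_lt_mul_of_pos_right h (Nat.succ_pos B)
    obtain ⟨r, hr⟩ := (hmono.tendsto_atTop.eventually hev).exists
    obtain ⟨β, q, a, h⟩ := exists_isRound hρ hB r
    refine (stCor_lt_iff_of_isRound hρ hB h).1 hr ?_
    have h1 := hτ ρ hc (r * (B + 1) + d + 2) (by rw [h.query]; rfl)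
    have h2 := memSeq_recordBits hρ hB h (fun _ : Fin d => (0 : Fin 2)) q (l := d + 2) (by omega)
      (by omega)
    rw [h.query] at h1
    have h3 : ρ (r * (B + 1) + d + 2 + 1) = RecallVertex.reply q (β q) := by
      rw [h1, ← h2]
      rfl
    have h4 := h.reply.symm.trans h3
    injection h4

theorem two_pow_le_of_recallGame (hB : d + 4 ≤ B) (τ : (recallGame d B).toArena.Strategy 1)
    (hτ : (B : ℕ∞) ≤ (recallGame d B).cost₁ τ) {k : ℕ} (hk : τ.ImplementableWith k) :
    2 ^ d ≤ k := by
  classical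
  by_contra! hlt
  obtain ⟨M, nxt, hM⟩ := hk.exists_memory
  let hub : RecallVertex d B := base (Fin.ofNat _ (d + 1))
  let path : (Fin d → Fin 2) → ℕ → RecallVertex d B := fun β l =>
    if l = 0 then base 0 else if h : l - 1 < d then bit ⟨l - 1, h⟩ (β ⟨l - 1, h⟩) else hub
  let walk : (Fin d → Fin 2) → Fin k → ℕ → Fin k := fun β m l =>
    Nat.rec m (fun l m => M.upd m (path β l) (path β (l + 1))) l
  -- The default 0 is immaterial: on the play built below, the move from a query is a reply.
  let resp : Fin d → Fin k → Fin 2 := fun q m =>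
    match nxt (query q) (M.upd m hub (query q)) with
    | reply _ a => a
    | _ => 0
  -- The state reached at the hub cannot encode all `2 ^ d` bit strings, so for some string a query
  -- is answered wrongly.
  have hbad : ∀ m, ∃ (β : Fin d → Fin 2) (q : Fin d), resp q (walk β m (d + 1)) ≠ β q := by
    intro m
    by_contra! hcon
    have hinj : Function.Injective fun β => walk β m (d + 1) := by
      intro β β' h
      funext q
      simp only at h
      rw [← hcon β q, h, hcon β' q]
    have := Fintype.card_le_of_injective _ hinj
    simp at this
    omega
  choose β q hbad using hbad
  let upd : Fin k × Fin k → RecallVertex d B → RecallVertex d B → Fin k × Fin k :=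
    fun m v w => (M.upd m.1 v w, if w = base 0 then M.upd m.1 v w else m.2)
  let nxt₀ : Fin k → RecallVertex d B → RecallVertex d B := fun m v =>
    v.next (q m) (match v with
      | bit i _ => if h : (i : ℕ) + 1 < d then β m ⟨i + 1, h⟩ else 0
      | _ => β m 0)
  obtain ⟨ρ, hρ, hc, hopp⟩ := exists_consistent_play τ (M.init, M.init) upd
    (fun v m => nxt₀ m.2 v) (fun v m _ => ⟨_, _, rfl⟩)
  have hfst : ∀ j, (memSeq (M.init, M.init) upd ρ j).1 = memSeq M.init M.upd ρ j := by
    intro j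
    induction j with
    | zero => rfl
    | succ j ih => rw [memSeq, memSeq, ← ih]
  -- Against the simulating opponent, Player 1 replies wrongly in every round, so each round costs
  -- at most `B - 1`.
  have hmain : ∀ r, (recallGame d B).stCor ρ (r * (B + 1)) ≤ ((B - 1 : ℕ) : ℕ∞) := by
    intro r
    obtain ⟨β', q', a, h⟩ := exists_isRound hρ hB r
    rw [stCor_lt_iff_of_isRound hρ hB h]
    set R := r * (B + 1) with hR
    set m := memSeq M.init M.upd ρ R with hm
    have hsnd : ∀ l, l ≤ B → (memSeq (M.init, M.init) upd ρ (R + l)).2 = m := by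
      intro l
      induction l with
      | zero =>
        intro _
        have h0 := h.start
        rw [add_zero, hm]
        cases hj : R with
        | zero => rfl
        | succ j =>
          rw [hj] at h0
          rw [← hfst, memSeq, h0]
          simp [upd]
      | succ l ih =>
        intro hl
        have hne : ρ (R + l + 1) ≠ base 0 := by
          intro h0
          have := eq_of_time hρ hB hR (by omega) (by omega) (congrArg time h0)
          simp only [time, Fin.val_zero] at this
          omega
        rw [← ih (by omega), ← add_assoc, memSeq]
        simp [upd, hne]
    have hpath : ∀ l, l ≤ d → ρ (R + l) = path (β m) l := by
      intro l
      induction l with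
      | zero => exact fun _ => h.start
      | succ l ih =>
        intro hl
        have h1 := hopp (R + l) (by
          cases l with
          | zero => rw [add_zero, h.start]; exact zero_ne_one
          | succ l =>
            rw [add_comm l 1, ← add_assoc, h.bits ⟨l, by omega⟩]
            exact zero_ne_one)
        rw [hsnd l (by omega), ih (by omega)] at h1
        rw [← add_assoc, h1]
        cases l with
        | zero =>
          simp only [path, nxt₀]
          rw [dif_pos (show 0 + 1 - 1 < d by omega)]
          rfl
        | succ l =>
          have hl' : l < d := by omega
          simp only [path, nxt₀, Nat.add_sub_cancel, dif_pos hl', dif_pos (show l + 1 < d by omega)]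
          simp [next, show l + 1 < d by omega]
    have hβ : β' = β m := by
      funext i
      have h1 := hpath (i + 1) i.2
      rw [add_comm (i : ℕ) 1, ← add_assoc, h.bits, add_comm 1 (i : ℕ)] at h1
      simp only [path, Nat.add_sub_cancel, dif_pos i.2] at h1
      rw [if_neg (Nat.succ_ne_zero _)] at h1
      injection h1
    have hq : q' = q m := by
      have h1 := hopp (R + d + 1) (by rw [h.hub]; exact zero_ne_one)
      rw [add_assoc R d 1, hsnd (d + 1) (by omega), ← add_assoc, h.hub] at h1
      have h2 := h.query.symm.trans h1
      have hv : ((Fin.ofNat (B + 1) (d + 1) : Fin (B + 1)) : ℕ) = d + 1 := by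
        rw [Fin.val_ofNat, Nat.mod_eq_of_lt (by omega)]
      have hne : (Fin.ofNat (B + 1) (d + 1) : Fin (B + 1)) ≠ 0 := by
        intro h
        rw [h] at hv
        simp at hv
      simp only [nxt₀, next, if_neg hne, if_pos hv] at h2
      injection h2
    have hpath' : ∀ l, l ≤ d + 1 → ρ (R + l) = path (β m) l := by
      intro l hl
      rcases Nat.lt_or_ge d l with h1 | h1
      · obtain rfl : l = d + 1 := by omega
        rw [← add_assoc, h.hub]
        simp [path, hub]
      · exact hpath l h1
    have hwalk : ∀ l, l ≤ d + 1 → memSeq M.init M.upd ρ (R + l) = walk (β m) m l := by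
      intro l
      induction l with
      | zero => exact fun _ => rfl
      | succ l ih =>
        intro hl
        rw [← add_assoc, memSeq, ih (by omega), hpath' l (by omega), add_assoc, hpath' _ hl]
    have h1 := hM ρ hρ hc (R + d + 2) (by rw [h.query]; rfl)
    have h2 : memSeq M.init M.upd ρ (R + d + 2) =
        M.upd (walk (β m) m (d + 1)) hub (RecallVertex.query (q m)) := by
      rw [← hwalk (d + 1) le_rfl, ← hq, ← h.query]
      change M.upd _ (ρ (R + d + 1)) _ = _
      rw [h.hub]
      rfl
    rw [h.query, h2] at h1
    have h3 := h.reply.symm.trans h1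
    rw [hβ, hq]
    rw [hq] at h3
    have h4 : resp (q m) (walk (β m) m (d + 1)) = a := by
      simp only [resp]
      rw [← h3]
    rw [← h4]
    exact hbad m
  have hcost := playCost_le_of_rounds (s := 0) hρ hB fun r _ => hmain r
  have h2 := hτ.trans (iInf₂_le (f := fun ρ _ => (recallGame d B).playCost ρ) ρ ⟨hρ, hc⟩)
  have h3 := Nat.cast_le.1 (h2.trans hcost)
  omega

end Rounds

theorem exists_lower_bound₁ : ∃ C : ℕ, ∀ d : ℕ, 1 ≤ d →
    ∃ (n : ℕ) (G : StreettGame (Fin n) (2 * d)),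
    n ≤ C * d ∧ G.IsFinitary ∧
    (∃ τ : G.toArena.Strategy 1, G.cost₁ τ = ((5 * (d - 1) + 7 : ℕ) : ℕ∞)) ∧
    ∀ τ : G.toArena.Strategy 1, ((5 * (d - 1) + 7 : ℕ) : ℕ∞) ≤ G.cost₁ τ →
      ((2 ^ d : ℕ) : ℕ∞) ≤ τ.size := by
  -- With `B = 5 * (d - 1) + 7` there are `10 * d + 3` vertices.
  refine ⟨13, fun d hd => ?_⟩
  have : NeZero d := ⟨by omega⟩
  have hB : d + 4 ≤ 5 * (d - 1) + 7 := by omega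
  obtain ⟨G, h1, h2, h3⟩ := exists_fin_game₁ (recallGame d (5 * (d - 1) + 7))
    recallGame_isFinitary (exists_strategy_recallGame hB)
    (fun τ hτ k hk => two_pow_le_of_recallGame hB τ hτ hk)
  refine ⟨_, G, ?_, h1, h2, h3⟩
  rw [card_eq]
  omega

end StreettGame

theorem mainTheorem10 :
    -- upper bounds, for arbitrary Streett games with costs
    (∀ (V : Type*) [Fintype V] (d : ℕ), 1 ≤ d → ∀ (G : StreettGame V d) (b : ℕ),
      ((∃ σ : G.toArena.Strategy 0, G.cost₀ σ ≤ b) →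
        ∃ σ' : G.toArena.Strategy 0, G.cost₀ σ' ≤ b ∧
          σ'.size ≤ (((d + 1).factorial * (b + 2) ^ d : ℕ) : ℕ∞)) ∧
      ((∃ τ : G.toArena.Strategy 1, (b : ℕ∞) ≤ G.cost₁ τ) →
        ∃ τ' : G.toArena.Strategy 1, (b : ℕ∞) ≤ G.cost₁ τ' ∧
          τ'.size ≤ ((Fintype.card V * (b + 2) ^ d : ℕ) : ℕ∞))) ∧
    -- lower bound for Player 0, already for finitary Streett games
    (∃ C : ℕ, ∀ d : ℕ, 1 ≤ d → ∃ (n : ℕ) (G : StreettGame (Fin n) d),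
      n ≤ C * d ^ 2 ∧ G.IsFinitary ∧
      (∃ σ : G.toArena.Strategy 0, G.cost₀ σ = ((d ^ 2 + 2 * d : ℕ) : ℕ∞)) ∧
      ∀ σ : G.toArena.Strategy 0, G.cost₀ σ ≤ ((d ^ 2 + 2 * d : ℕ) : ℕ∞) →
        ((2 ^ (d - 1) : ℕ) : ℕ∞) ≤ σ.size) ∧
    -- lower bound for Player 1, already for finitary Streett games
    (∃ C : ℕ, ∀ d : ℕ, 1 ≤ d → ∃ (n : ℕ) (G : StreettGame (Fin n) (2 * d)),
      n ≤ C * d ∧ G.IsFinitary ∧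
      (∃ τ : G.toArena.Strategy 1, G.cost₁ τ = ((5 * (d - 1) + 7 : ℕ) : ℕ∞)) ∧
      ∀ τ : G.toArena.Strategy 1, ((5 * (d - 1) + 7 : ℕ) : ℕ∞) ≤ G.cost₁ τ →
        ((2 ^ d : ℕ) : ℕ∞) ≤ τ.size) := by
  exact ⟨fun V _ d hd G b => ⟨StreettGame.exists_small_strategy₀ hd,
    StreettGame.exists_small_strategy₁⟩, StreettGame.exists_lower_bound₀,
    StreettGame.exists_lower_bound₁⟩
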